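/- Functions in $\mathcal M_+(0,1)$ are the Lebesgue measurable functions $(0,1)\to[0,\infty]$. For such $g$ let $g^*(s)=\sup\{t\in\mathbb R:|\{x\in(0,1):g(x)>t\}|>s\}$ be its decreasing rearrangement and $g^{**}(s)=\frac1s\int_0^s g^*(r)\,dr$, for $s\in(0,1)$. A rearrangement-invariant function norm is a map $\|\cdot\|_X:\mathcal M_+(0,1)\to[0,\infty]$ such that, for all $f,g,f_j\in\mathcal M_+(0,1)$ and $\lambda\ge0$: $\|f\|_X=0$ iff $f=0$ a.e., $\|\lambda f\|_X=\lambda\|f\|_X$, $\|f+g\|_X\le\|f\|_X+\|g\|_X$; $f\le g$ a.e. implies $\|f\|_X\le\|g\|_X$; $f_j\nearrow f$ a.e. implies $\|f_j\|_X\nearrow\|f\|_X$; $\|1\|_X<\infty$; $\int_0^1 f\le C\|f\|_X$ with $C$ independent of $f$; and $\|f\|_X=\|g\|_X$ whenever $f^*=g^*$. Its fundamental function is $\varphi_X(t)=\|\chi_{(0,t)}\|_X$, and for a functional $N:\mathcal M_+(0,1)\to[0,\infty]$ its associate functional is $N'(g)=\sup\{\int_0^1 fg: f\in\mathcal M_+(0,1),\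 N(f)\le1\}$; write $\|\cdot\|_{X'}$ for the associate functional of $\|\cdot\|_X$. For $p\in(1,\infty)$ put $\|g\|_{X^p}=\|g^p\|_X^{1/p}$. Let $I:(0,1)\to(0,\infty)$ be non-decreasing. For $g\in\mathcal M_+(0,1)$ let $H_Ig(t)=\int_t^1\frac{g(r)}{I(r)}\,dr$, $t\in(0,1)$, and let $H_I^k$ be the $k$-fold composition of $H_I$. For $k\in\mathbb N$, $k\ge1$, let $$\|g\|_{X_k'}=\left\|\frac1{I(t)}\int_0^t g^*(s)\left(\int_s^t\frac{dr}{I(r)}\right)^{k-1}ds\right\|_{X'},$$ and let $\|\cdot\|_{X_k}$ be the associate functional of $\|\cdot\|_{X_k'}$. (When $\inf_{t\in(0,1)}I(t)/t>0$, this is the norm of the smallest rearrangement-invariant space into which $H_I^k$ maps $X$ boundedly.) **Lemma.** Let $m\in\mathbb N$, $m\ge2$, let $I:(0,1)\to(0,\infty)$ be non-decreasing, set $\psi_I(t)=\left(\int_0^t\frac{dr}{I(r)}\right)^m$ for $t\in(0,1)$, and let $\|\cdot\|_X$ be a rearrangement-invariant function norm. The following statements are equivalent (with the convention $0\cdot\infty=0$).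 (i) $\int_0\frac{ds}{I(s)}<\infty$ (convergence at $0$), and there is $C>0$ with $\sup_{t\in(0,1)}g^{**}(t)\psi_I(t)\le C\|g\|_X$ for every $g\in\mathcal M_+(0,1)$. (ii) $\int_0\frac{ds}{I(s)}<\infty$, and there is $C>0$ with $\sup_{t\in(0,1)}g^{*}(t)\psi_I(t)\le C\|g\|_X$ for every $g\in\mathcal M_+(0,1)$. (iii) For every integer $1\le k\le m-1$ there is $C>0$ with $\|g\|_{X^{m/(m-k)}}\le C\|g\|_{X_k}$ for every $g\in\mathcal M_+(0,1)$. (iv) For every integer $1\le k\le m-1$ there is $C>0$ with $\|fg\|_X\le C\|f\|_{X_k}\|g\|_{X_{m-k}}$ for every $f,g\in\mathcal M_+(0,1)$. (v) There are an integer $1\le k\le m-1$ and $C>0$ with $\|fg\|_X\le C\|f\|_{X_k}\|g\|_{X_{m-k}}$ for every $f,g\in\mathcal M_+(0,1)$. (vi) There are an integer $1\le k\le m-1$ and $C>0$ with $\|H_I^kf\cdot H_I^{m-k}g\|_X\le C\|f\|_X\|g\|_X$ for every $f,g\in\mathcal M_+(0,1)$. (vii) There is $C>0$ with $\left(\int_0^t\frac{ds}{I(s)}\right)^m\le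 C\varphi_X(t)$ for every $t\in(0,1)$. -/

import Mathlib

open MeasureTheory Set Filter Topology
open scoped ENNReal NNReal

noncomputable section

namespace RISpace

/-- Lebesgue measure on the interval `(0, 1)`. -/
abbrev leb : Measure ℝ := volume.restrict (Ioo (0 : ℝ) 1)

/-- The class `M_+(0,1)` of Lebesgue measurable functions from `(0,1)` into `[0, ∞]`. Functions
are represented by functions on `ℝ`, whose values outside `(0,1)` are irrelevant. -/
def MPlus (f : ℝ → ℝ≥0∞) : Prop := AEMeasurable f leb

/-- The decreasing rearrangement `f*(s) = sup {t : |{x ∈ (0,1) : f x > t}| > s}`, `s ∈ (0,1)`. -/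
def rearr (f : ℝ → ℝ≥0∞) (s : ℝ) : ℝ≥0∞ :=
  ⨆ (t : ℝ≥0) (_ : ENNReal.ofReal s < leb {x | (t : ℝ≥0∞) < f x}), (t : ℝ≥0∞)

/-- The maximal function `f**(s) = (1/s) ∫_0^s f*(r) dr`, `s ∈ (0,1)`. -/
def maxRearr (f : ℝ → ℝ≥0∞) (s : ℝ) : ℝ≥0∞ :=
  (ENNReal.ofReal s)⁻¹ * ∫⁻ r in Ioo 0 s, rearr f r

/-- A rearrangement-invariant function norm on `M_+(0,1)`. Only the values of `norm` on functions
in `M_+(0,1)` are meaningful. -/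
structure RIFunctionNorm where
  norm : (ℝ → ℝ≥0∞) → ℝ≥0∞
  norm_eq_zero_iff : ∀ f, MPlus f → (norm f = 0 ↔ f =ᵐ[leb] 0)
  norm_smul : ∀ f, MPlus f → ∀ c : ℝ≥0, norm (fun x => (c : ℝ≥0∞) * f x) = c * norm f
  norm_add_le : ∀ f g, MPlus f → MPlus g → norm (fun x => f x + g x) ≤ norm f + norm g
  norm_mono : ∀ f g, MPlus f → MPlus g → f ≤ᵐ[leb] g → norm f ≤ norm g
  /-- The Fatou property; that the norms increase is part of `norm_mono`. -/
  norm_fatou : ∀ (f : ℕ → ℝ → ℝ≥0∞) (F : ℝ → ℝ≥0∞), (∀ j, MPlus (f j)) → MPlus F →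
    (∀ᵐ x ∂leb, Monotone (fun j => f j x) ∧ Tendsto (fun j => f j x) atTop (𝓝 (F x))) →
    Tendsto (fun j => norm (f j)) atTop (𝓝 (norm F))
  norm_one_lt_top : norm (fun _ => 1) < ∞
  lintegral_le : ∃ C : ℝ≥0, ∀ f, MPlus f → ∫⁻ x in Ioo 0 1, f x ≤ C * norm f
  norm_rearr : ∀ f g, MPlus f → MPlus g → (∀ s ∈ Ioo (0 : ℝ) 1, rearr f s = rearr g s) →
    norm f = norm g

/-- The functional associated with a functional `N` on `M_+(0,1)`:
`N'(g) = sup {∫_0^1 f g : f ∈ M_+(0,1), N f ≤ 1}`. -/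
def assoc (N : (ℝ → ℝ≥0∞) → ℝ≥0∞) (g : ℝ → ℝ≥0∞) : ℝ≥0∞ :=
  ⨆ (f : ℝ → ℝ≥0∞) (_ : MPlus f) (_ : N f ≤ 1), ∫⁻ s in Ioo 0 1, f s * g s

/-- The fundamental function `φ_X(t) = ‖χ_{(0,t)}‖_X`. -/
def fundamental (X : RIFunctionNorm) (t : ℝ) : ℝ≥0∞ :=
  X.norm ((Ioo 0 t).indicator (fun _ => 1))

/-- The functional `‖g‖_{X^p} = ‖g^p‖_X^{1/p}`. -/
def powNorm (X : RIFunctionNorm) (p : ℝ) (g : ℝ → ℝ≥0∞) : ℝ≥0∞ :=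
  (X.norm (fun x => g x ^ p)) ^ (1 / p)

/-- The integral `∫_s^t dr / I(r)` as an element of `[0, ∞]`, for `0 ≤ s ≤ t ≤ 1`. -/
def invInt (I : ℝ → ℝ) (s t : ℝ) : ℝ≥0∞ :=
  ∫⁻ r in Ioo s t, (ENNReal.ofReal (I r))⁻¹

/-- The condition `∫_0 ds / I(s) < ∞` (convergence of the integral at `0`). -/
def ConvergesAtZero (I : ℝ → ℝ) : Prop :=
  ∃ δ ∈ Ioo (0 : ℝ) 1, invInt I 0 δ < ∞

/-- `ψ_I(t) = (∫_0^t dr / I(r))^m`. -/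
def psi (I : ℝ → ℝ) (m : ℕ) (t : ℝ) : ℝ≥0∞ := invInt I 0 t ^ m

/-- The operator `H_I g(t) = ∫_t^1 g(r) / I(r) dr`, `t ∈ (0,1)`. Its `k`-fold composition `H_I^k`
is `(hardy I)^[k]`. -/
def hardy (I : ℝ → ℝ) (g : ℝ → ℝ≥0∞) (t : ℝ) : ℝ≥0∞ :=
  ∫⁻ r in Ioo t 1, g r / ENNReal.ofReal (I r)

/-- For `k ≥ 1`, the functional
`‖g‖_{X_k'} = ‖ (1/I(t)) ∫_0^t g*(s) (∫_s^t dr/I(r))^{k-1} ds ‖_{X'}`. -/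
def optAssocNorm (X : RIFunctionNorm) (I : ℝ → ℝ) (k : ℕ) (g : ℝ → ℝ≥0∞) : ℝ≥0∞ :=
  assoc X.norm (fun t =>
    (ENNReal.ofReal (I t))⁻¹ * ∫⁻ s in Ioo 0 t, rearr g s * invInt I s t ^ (k - 1))

/-- For `k ≥ 1`, the norm of `X_k`, the optimal range space for `H_I^k` on `X`: it is the functional
associated with `‖·‖_{X_k'}`. -/
def optNorm (X : RIFunctionNorm) (I : ℝ → ℝ) (k : ℕ) (f : ℝ → ℝ≥0∞) : ℝ≥0∞ :=
  assoc (optAssocNorm X I k) f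

end RISpace

end

/-! Everything is equivalent to the growth condition (vii) on the fundamental function `φ`. Write
`Φ(t)` for the integral of `1/I` over `(0,t)` and `D(e,a)` for that over `(e,a)`.

The weak-type statements: averaging translates of `g*χ_(0,t)` gives `g** φ ≤ 2‖g‖`
(`maxRearr_mul_fundamental_le`), so (vii) implies (i), which implies (ii) by `g* ≤ g**`. Testing
(ii) on characteristic functions returns (vii), because `Φ` is doubling.

From (vii) to (iii): the core is that the iterated Hardy operator maps `X` into `X^{m/(m-k)}`
(`exists_norm_kern_rpow_le`). Up to constants and a dilation, `u` may be replaced by a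
non-increasing function `V`, the majorant of its dyadic averages, at the cost of a factor in norm.
Then `Vφ ≤ ‖V‖`, so `VΦ^m` is bounded, and splitting the integral of `VΦ^{k-1}dΦ` where `Φ =
V(t)^{-1/m}` bounds it by a multiple of `V(t)^{(m-k)/m}` (`hedberg_antitone`). The embedding of
`X_k` follows by duality in `exists_powNorm_le_optNorm`: a Hölder extremal `f` for `g^p` is tested
in `X_k'`. That norm involves `f*`, which a measure-preserving map carries below `f`; the other
ingredient is that a function norm is its own second associate.

Hölder's inequality with exponents `m/(m-k)` and `m/k` turns (iii) into (iv). The operator `H_I^k`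
maps `X` into `X_k` with norm at most one, so (v) gives (vi).

From (vi) to (vii): testing with `χ_(0,a)` in both factors gives `D(e,a)^m φ(e) ≤ C φ(a)^2` for `e <
a`. This is the desired bound only when `φ(e)` and `φ(a)` are comparable; in general one chains
points along which `φ` is roughly halved. The `m`-th roots of the pieces then form a geometric
series (`exists_pow_le_of_halving`), and `e → 0` finishes. -/

namespace RISpace

/-! ### Distribution functions, rearrangements and dilations -/

lemma volume_setOf_ofReal_lt (a : ℝ≥0∞) : volume {s : ℝ | 0 < s ∧ ENNReal.ofReal s < a} = a := by
  rcases eq_or_ne a ∞ with rfl | ha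
  · have : {s : ℝ | 0 < s ∧ ENNReal.ofReal s < ∞} = Ioi 0 := by
      ext s; simp
    rw [this]; simp
  · have : {s : ℝ | 0 < s ∧ ENNReal.ofReal s < a} = Ioo 0 a.toReal := by
      ext s
      simp only [mem_ofPred_eq, mem_Ioo]
      refine and_congr_right fun hs => ?_
      rw [ENNReal.ofReal_lt_iff_lt_toReal hs.le ha]
    rw [this]; simp [ha]

lemma leb_univ : leb univ = 1 := by simp

lemma leb_le_one (A : Set ℝ) : leb A ≤ 1 := by
  rw [← leb_univ]; exact measure_mono (subset_univ _)

lemma leb_setOf_ofReal_lt {a : ℝ≥0∞} (ha : a ≤ 1) : leb {s : ℝ | ENNReal.ofReal s < a} = a := by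
  rw [Measure.restrict_apply' measurableSet_Ioo]
  have : {s : ℝ | ENNReal.ofReal s < a} ∩ Ioo 0 1 = {s : ℝ | 0 < s ∧ ENNReal.ofReal s < a} := by
    ext s
    simp only [mem_inter_iff, mem_ofPred_eq, mem_Ioo]
    constructor
    · rintro ⟨h, h0, -⟩; exact ⟨h0, h⟩
    · rintro ⟨h0, h⟩
      refine ⟨h, h0, ?_⟩
      have := h.trans_le ha
      simpa using this
  rw [this, volume_setOf_ofReal_lt]

/-- Right-continuity of the distribution function: the superlevel set at `c` is the increasing union
of those at `c + 1/(n+1)`, so a strict lower bound on its measure survives at a slightly higher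
level. -/
lemma lt_rearr_iff (f : ℝ → ℝ≥0∞) (s : ℝ) (c : ℝ≥0) :
    (c : ℝ≥0∞) < rearr f s ↔ ENNReal.ofReal s < leb {x | (c : ℝ≥0∞) < f x} := by
  unfold rearr
  simp only [lt_iSup_iff]
  constructor
  · rintro ⟨t, ht, hct⟩
    refine ht.trans_le (measure_mono fun x hx => ?_)
    exact hct.trans hx
  · intro h
    have hU : {x | (c : ℝ≥0∞) < f x} = ⋃ n : ℕ, {x | ((c + 1 / ((n : ℝ≥0) + 1) : ℝ≥0) : ℝ≥0∞) < f x} := by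
      ext x
      simp only [mem_ofPred_eq, mem_iUnion]
      constructor
      · intro hx
        obtain ⟨d, hd1, hd2⟩ := ENNReal.lt_iff_exists_nnreal_btwn.1 hx
        have hd1' : c < d := by exact_mod_cast hd1
        obtain ⟨n, hn⟩ := exists_nat_one_div_lt (sub_pos.2 (NNReal.coe_lt_coe.2 hd1'))
        refine ⟨n, lt_trans ?_ hd2⟩
        rw [ENNReal.coe_lt_coe, ← NNReal.coe_lt_coe]
        push_cast
        linarith
      · rintro ⟨n, hn⟩
        refine lt_of_le_of_lt ?_ hn
        rw [ENNReal.coe_le_coe]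
        exact le_self_add
    have hmono : Monotone fun n : ℕ => {x | ((c + 1 / ((n : ℝ≥0) + 1) : ℝ≥0) : ℝ≥0∞) < f x} := by
      intro i j hij x hx
      simp only [mem_ofPred_eq] at hx ⊢
      refine lt_of_le_of_lt ?_ hx
      rw [ENNReal.coe_le_coe]
      gcongr
    rw [hU, hmono.measure_iUnion, lt_iSup_iff] at h
    obtain ⟨n, hn⟩ := h
    refine ⟨_, hn, ?_⟩
    rw [ENNReal.coe_lt_coe]
    exact lt_add_of_pos_right _ (by positivity)

lemma rearr_antitone (f : ℝ → ℝ≥0∞) : Antitone (rearr f) := by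
  intro s t hst
  refine le_of_forall_lt_imp_le_of_dense fun a ha => ?_
  obtain ⟨d, hd1, hd2⟩ := ENNReal.lt_iff_exists_nnreal_btwn.1 ha
  rw [lt_rearr_iff] at hd2
  refine hd1.le.trans (le_of_lt ?_)
  rw [lt_rearr_iff]
  exact (ENNReal.ofReal_le_ofReal hst).trans_lt hd2

lemma measurable_rearr (f : ℝ → ℝ≥0∞) : Measurable (rearr f) := (rearr_antitone f).measurable

lemma rearr_le_of_dist {f g : ℝ → ℝ≥0∞} {s t : ℝ}
    (h : ∀ c : ℝ≥0, ENNReal.ofReal s < leb {x | (c : ℝ≥0∞) < f x} →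
      ENNReal.ofReal t < leb {x | (c : ℝ≥0∞) < g x}) : rearr f s ≤ rearr g t := by
  refine le_of_forall_lt_imp_le_of_dense fun a ha => ?_
  obtain ⟨d, hd1, hd2⟩ := ENNReal.lt_iff_exists_nnreal_btwn.1 ha
  rw [lt_rearr_iff] at hd2
  exact hd1.le.trans ((lt_rearr_iff _ _ _).2 (h d hd2)).le

lemma leb_lt_rearr (f : ℝ → ℝ≥0∞) (c : ℝ≥0) :
    leb {x | (c : ℝ≥0∞) < rearr f x} = leb {x | (c : ℝ≥0∞) < f x} := by
  simp only [lt_rearr_iff]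
  exact leb_setOf_ofReal_lt (leb_le_one _)

namespace RIFunctionNorm
variable (X : RIFunctionNorm)

lemma norm_congr {f g : ℝ → ℝ≥0∞} (hf : MPlus f) (h : f =ᵐ[leb] g) : X.norm f = X.norm g :=
  have hg : MPlus g := hf.congr h
  le_antisymm (X.norm_mono f g hf hg h.le) (X.norm_mono g f hg hf h.symm.le)

lemma norm_rearr_self {f : ℝ → ℝ≥0∞} (hf : MPlus f) : X.norm (rearr f) = X.norm f := by
  refine X.norm_rearr _ _ (measurable_rearr f).aemeasurable hf fun s _ => ?_
  refine le_antisymm (rearr_le_of_dist fun c => ?_) (rearr_le_of_dist fun c => ?_) <;>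
  rw [leb_lt_rearr] <;> exact id

/-- Ordered distribution functions give pointwise ordered rearrangements, and passing to the
rearrangement does not change the norm. -/
lemma norm_le_of_dist_le {f g : ℝ → ℝ≥0∞} (hf : MPlus f) (hg : MPlus g)
    (h : ∀ c : ℝ≥0, leb {x | (c : ℝ≥0∞) < f x} ≤ leb {x | (c : ℝ≥0∞) < g x}) :
    X.norm f ≤ X.norm g := by
  rw [← X.norm_rearr_self hf, ← X.norm_rearr_self hg]
  refine X.norm_mono _ _ (measurable_rearr f).aemeasurable (measurable_rearr g).aemeasurable ?_
  exact Eventually.of_forall fun s => rearr_le_of_dist fun c hc => hc.trans_le (h c)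

end RIFunctionNorm

lemma leb_preimage_mul_le {l : ℝ} (hl : 0 < l) (A : Set ℝ) (hA : A ⊆ Ioo 0 1):
    leb ((fun x => l * x) ⁻¹' A) ≤ ENNReal.ofReal l⁻¹ * leb A := by
  calc leb ((fun x => l * x) ⁻¹' A) ≤ volume ((fun x => l * x) ⁻¹' A) := Measure.restrict_apply_le _ _
    _ = ENNReal.ofReal l⁻¹ * volume A := by
      rw [Real.volume_preimage_mul_left hl.ne', abs_of_pos (inv_pos.2 hl)]
    _ = ENNReal.ofReal l⁻¹ * leb A := by
      rw [Measure.restrict_apply' measurableSet_Ioo, inter_eq_left.2 hA]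

lemma leb_preimage_affine {A : Set ℝ} (hA : A ⊆ Ioo 0 1) {b : ℝ} (hb : b = 0 ∨ b = 1) :
    leb ((fun x => 2 * x - b) ⁻¹' A) = 2⁻¹ * leb A := by
  have h1 : (fun x => 2 * x - b) ⁻¹' A = (fun x => 2 * x) ⁻¹' ((fun x => x - b) ⁻¹' A) := rfl
  have h2 : (fun x => 2 * x - b) ⁻¹' A ⊆ Ioo 0 1 := by
    intro x hx
    have := hA hx
    simp only [mem_Ioo] at this ⊢
    rcases hb with rfl | rfl <;> constructor <;> linarith [this.1, this.2]
  rw [Measure.restrict_apply' measurableSet_Ioo, Measure.restrict_apply' measurableSet_Ioo,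
    inter_eq_left.2 hA, inter_eq_left.2 h2, h1, Real.volume_preimage_mul_left two_ne_zero]
  have : volume ((fun x => x - b) ⁻¹' A) = volume A := by
    simp only [sub_eq_add_neg]; exact measure_preimage_add_right volume (-b) A
  rw [this, abs_of_pos (by norm_num), ENNReal.ofReal_inv_of_pos (by norm_num)]
  simp

namespace RIFunctionNorm
variable (X : RIFunctionNorm)

/-- Squeeze `f*` into the left and into the right half of the interval. Each copy has half the
distribution function of `f`, hence norm at most that of `g`; their supports are disjoint, so the
sum is equimeasurable with `f`. All dilation bounds below come from this. -/
lemma norm_le_two_mul_of_dist_le {f g : ℝ → ℝ≥0∞} (hf : MPlus f) (hg : MPlus g)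
    (h : ∀ c : ℝ≥0, leb {x | (c : ℝ≥0∞) < f x} ≤ 2 * leb {x | (c : ℝ≥0∞) < g x}) :
    X.norm f ≤ 2 * X.norm g := by
  set f0 : ℝ → ℝ≥0∞ := (Ioo 0 1).indicator (rearr f) with hf0
  have hm0 : Measurable f0 := (measurable_rearr f).indicator measurableSet_Ioo
  set F : ℝ → ℝ → ℝ≥0∞ := fun b x => f0 (2 * x - b) with hF
  have hmF : ∀ b, Measurable (F b) := fun b => hm0.comp (by fun_prop)
  have hsub : ∀ c : ℝ≥0, {x | (c : ℝ≥0∞) < f0 x} ⊆ Ioo 0 1 := by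
    intro c x hx
    by_contra h'
    simp [hf0, h'] at hx
  have hd0 : ∀ c : ℝ≥0, leb {x | (c : ℝ≥0∞) < f0 x} = leb {x | (c : ℝ≥0∞) < f x} := by
    intro c
    rw [← leb_lt_rearr f]
    refine measure_congr ?_
    filter_upwards [ae_restrict_mem measurableSet_Ioo] with x hx
    simp only [eq_iff_iff]
    change ((c : ℝ≥0∞) < f0 x) ↔ ((c : ℝ≥0∞) < rearr f x)
    simp [hf0, hx]
  have hdF : ∀ b, b = 0 ∨ b = 1 → ∀ c : ℝ≥0,
      leb {x | (c : ℝ≥0∞) < F b x} = 2⁻¹ * leb {x | (c : ℝ≥0∞) < f x} := by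
    intro b hb c
    rw [← hd0 c, ← leb_preimage_affine (hsub c) hb]; rfl
  have hn : ∀ b, b = 0 ∨ b = 1 → X.norm (F b) ≤ X.norm g := by
    intro b hb
    refine X.norm_le_of_dist_le (hmF b).aemeasurable hg fun c => ?_
    rw [hdF b hb c]
    calc _ ≤ 2⁻¹ * (2 * leb {x | (c : ℝ≥0∞) < g x}) := by gcongr; exact h c
      _ = _ := by rw [← mul_assoc, ENNReal.inv_mul_cancel two_ne_zero ENNReal.ofNat_ne_top, one_mul]
  calc X.norm f ≤ X.norm (fun x => F 0 x + F 1 x) := by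
        refine X.norm_le_of_dist_le hf ((hmF 0).add (hmF 1)).aemeasurable fun c => ?_
        calc leb {x | (c : ℝ≥0∞) < f x}
            = leb {x | (c : ℝ≥0∞) < F 0 x} + leb {x | (c : ℝ≥0∞) < F 1 x} := by
              rw [hdF 0 (Or.inl rfl), hdF 1 (Or.inr rfl), ← add_mul, ENNReal.inv_two_add_inv_two, one_mul]
          _ = leb ({x | (c : ℝ≥0∞) < F 0 x} ∪ {x | (c : ℝ≥0∞) < F 1 x}) := by
              rw [measure_union]
              · rw [Set.disjoint_left]
                intro x h0 h1
                have h0' := hsub c h0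
                have h1' := hsub c h1
                simp only [mem_Ioo] at h0' h1'
                linarith [h0'.2, h1'.1]
              · exact measurableSet_lt measurable_const (hmF 1)
          _ ≤ _ := by
              refine measure_mono ?_
              rintro x (hx | hx) <;> simp only [mem_ofPred_eq] at hx ⊢
              · exact lt_of_lt_of_le hx le_self_add
              · exact lt_of_lt_of_le hx le_add_self
    _ ≤ X.norm (F 0) + X.norm (F 1) := X.norm_add_le _ _ (hmF 0).aemeasurable (hmF 1).aemeasurable
    _ ≤ X.norm g + X.norm g := add_le_add (hn 0 (Or.inl rfl)) (hn 1 (Or.inr rfl))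
    _ = 2 * X.norm g := (two_mul _).symm

lemma norm_comp_measurePreserving {f : ℝ → ℝ≥0∞} (hf : Measurable f) {σ : ℝ → ℝ}
    (hσ : MeasurePreserving σ leb leb) : X.norm (fun x => f (σ x)) ≤ X.norm f := by
  refine X.norm_le_of_dist_le (hf.comp hσ.measurable).aemeasurable hf.aemeasurable fun c => ?_
  exact (hσ.measure_preimage (measurableSet_lt measurable_const hf).nullMeasurableSet).le

end RIFunctionNorm

/-! ### Hardy–Littlewood inequality and measure-preserving rearrangement -/

/-- Over sets of given measure, the integral of a non-increasing function is largest on an initial interval. -/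
lemma setLIntegral_le_of_antitoneOn {w : ℝ → ℝ≥0∞} (hw : AntitoneOn w (Ioo 0 1)) {E : Set ℝ}
    (hE : MeasurableSet E) :
    ∫⁻ x in E, w x ∂leb ≤ ∫⁻ x in {s : ℝ | ENNReal.ofReal s < leb E}, w x ∂leb := by
  set B : Set ℝ := {s : ℝ | ENNReal.ofReal s < leb E} with hBdef
  have hB : MeasurableSet B := measurableSet_lt ENNReal.measurable_ofReal measurable_const
  have hBE : leb B = leb E := leb_setOf_ofReal_lt (leb_le_one _)
  have hdiff : leb (E \ B) = leb (B \ E) := by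
    have h1 := measure_inter_add_sdiff (μ := leb) E hB
    have h2 := measure_inter_add_sdiff (μ := leb) B hE
    rw [inter_comm B E, hBE, ← h1] at h2
    exact ((ENNReal.add_right_inj (ne_top_of_le_ne_top ENNReal.one_ne_top (leb_le_one _))).1 h2).symm
  rw [← lintegral_inter_add_sdiff w E hB, ← lintegral_inter_add_sdiff w B hE, inter_comm B E]
  gcongr 1
  rcases eq_or_ne (leb (E \ B)) 0 with h0 | h0
  · rw [setLIntegral_measure_zero _ _ h0]; exact zero_le
  -- the value of `w` at the right endpoint of `B` separates
  set b : ℝ := (leb E).toReal with hb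
  have hfin : leb E ≠ ∞ := ne_top_of_le_ne_top ENNReal.one_ne_top (leb_le_one _)
  have hEpos : 0 < b := by
    refine ENNReal.toReal_pos (fun h => h0 (measure_mono_null sdiff_subset h)) hfin
  have hb1 : b < 1 := by
    by_contra hcon
    push Not at hcon
    refine h0 ?_
    have : leb Bᶜ = 0 := by
      rw [measure_compl hB (by rw [hBE]; exact hfin), hBE, leb_univ]
      refine tsub_eq_zero_of_le ?_
      rw [← ENNReal.ofReal_toReal hfin, ← hb]
      simpa using hcon
    exact measure_mono_null (fun x hx => hx.2) this
  have hmem : ∀ x, 0 < x → (x ∈ B ↔ x < b) := by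
    intro x hx
    rw [hBdef, mem_ofPred_eq, ENNReal.ofReal_lt_iff_lt_toReal hx.le hfin]
  calc ∫⁻ x in E \ B, w x ∂leb ≤ ∫⁻ x in E \ B, w b ∂leb := by
        refine lintegral_mono_ae ?_
        rw [ae_restrict_iff' (hE.diff hB)]
        filter_upwards [ae_restrict_mem measurableSet_Ioo] with x hx hxE
        refine hw ⟨hEpos, hb1⟩ hx ?_
        by_contra hcon
        exact hxE.2 ((hmem x hx.1).2 (not_le.1 hcon))
    _ = ∫⁻ x in B \ E, w b ∂leb := by simp [hdiff]
    _ ≤ ∫⁻ x in B \ E, w x ∂leb := by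
        refine lintegral_mono_ae ?_
        rw [ae_restrict_iff' (hB.diff hE)]
        filter_upwards [ae_restrict_mem measurableSet_Ioo] with x hx hxE
        exact hw hx ⟨hEpos, hb1⟩ ((hmem x hx.1).1 hxE.1).le

/-- Layer-cake formula: `h x` is the length of the set of `c > 0` below it; then Tonelli. -/
lemma lintegral_mul_eq_layercake {h w : ℝ → ℝ≥0∞} (hh : Measurable h) (hw : Measurable w) :
    ∫⁻ x, h x * w x ∂leb = ∫⁻ c in Ioi (0 : ℝ), ∫⁻ x in {x | ENNReal.ofReal c < h x}, w x ∂leb := by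
  have hS : MeasurableSet {q : ℝ × ℝ | ENNReal.ofReal q.1 < h q.2} :=
    measurableSet_lt (by fun_prop) (by fun_prop)
  have e1 : ∀ c : ℝ, ∫⁻ x in {x | ENNReal.ofReal c < h x}, w x ∂leb =
      ∫⁻ x, {q : ℝ × ℝ | ENNReal.ofReal q.1 < h q.2}.indicator (fun q => w q.2) (c, x) ∂leb := by
    intro c
    rw [← lintegral_indicator (measurableSet_lt measurable_const hh)]
    rfl
  simp_rw [e1]
  have hmeas : Measurable ({q : ℝ × ℝ | ENNReal.ofReal q.1 < h q.2}.indicator (fun q => w q.2)) :=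
    Measurable.indicator (by fun_prop) hS
  rw [lintegral_lintegral_swap (f := fun c x =>
    {q : ℝ × ℝ | ENNReal.ofReal q.1 < h q.2}.indicator (fun q => w q.2) (c, x)) hmeas.aemeasurable]
  refine lintegral_congr fun x => ?_
  have e2 : ∀ c : ℝ, {q : ℝ × ℝ | ENNReal.ofReal q.1 < h q.2}.indicator (fun q => w q.2) (c, x) =
      {c : ℝ | ENNReal.ofReal c < h x}.indicator (fun _ => w x) c := fun c => rfl
  simp_rw [e2]
  have hm : MeasurableSet {c : ℝ | ENNReal.ofReal c < h x} :=
    measurableSet_lt ENNReal.measurable_ofReal measurable_const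
  rw [lintegral_indicator hm, Measure.restrict_restrict hm, setLIntegral_const, mul_comm]
  congr 1
  refine (volume_setOf_ofReal_lt (h x)).symm.trans ?_
  congr 1
  ext c; simp [and_comm]

lemma rearr_congr {f g : ℝ → ℝ≥0∞} (h : f =ᵐ[leb] g) : rearr f = rearr g := by
  have : ∀ t : ℝ≥0, leb {x | (t : ℝ≥0∞) < f x} = leb {x | (t : ℝ≥0∞) < g x} := fun t =>
    measure_congr (by filter_upwards [h] with x hx; exact congrArg (fun a => (t : ℝ≥0∞) < a) hx)
  funext s
  simp only [rearr, this]

/-- The Hardy–Littlewood inequality against a non-increasing function. -/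
lemma lintegral_mul_le_rearr {h w : ℝ → ℝ≥0∞} (hh : MPlus h) (hw : Measurable w)
    (hanti : AntitoneOn w (Ioo 0 1)) :
    ∫⁻ x, h x * w x ∂leb ≤ ∫⁻ x, rearr h x * w x ∂leb := by
  have hae : h =ᵐ[leb] hh.mk h := hh.ae_eq_mk
  have hm : Measurable (hh.mk h) := hh.measurable_mk
  rw [rearr_congr hae, lintegral_congr_ae (g := fun x => hh.mk h x * w x)
    (by filter_upwards [hae] with x hx; rw [hx]), lintegral_mul_eq_layercake hm hw,
    lintegral_mul_eq_layercake (measurable_rearr _) hw]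
  refine lintegral_mono fun c => ?_
  -- Level by level: each superlevel set of `h*` is exactly the initial interval having the measure
  -- of that of `h`.
  refine (setLIntegral_le_of_antitoneOn hanti (measurableSet_lt measurable_const hm)).trans_eq ?_
  congr 2
  ext s
  exact (lt_rearr_iff _ s c.toNNReal).symm


instance : IsProbabilityMeasure leb := ⟨leb_univ⟩

lemma leb_lt_rearr_at (f : ℝ → ℝ≥0∞) {b : ℝ} : leb {x | rearr f b < f x} ≤ ENNReal.ofReal b := by
  rcases eq_or_ne (rearr f b) ∞ with h | h
  · simp [h]
  · lift rearr f b to ℝ≥0 using h with c hc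
    by_contra hcon
    push Not at hcon
    rw [← lt_rearr_iff, ← hc] at hcon
    exact lt_irrefl _ hcon

lemma le_leb_rearr_at {f : ℝ → ℝ≥0∞} (hf : Measurable f) {b : ℝ} (hb1 : b ≤ 1) :
    ENNReal.ofReal b ≤ leb {x | rearr f b ≤ f x} := by
  have hb1' : ENNReal.ofReal b ≤ 1 := by simpa using hb1
  have hkey : leb {x | f x < rearr f b} ≤ 1 - ENNReal.ofReal b := by
    rcases eq_or_ne (rearr f b) 0 with h | h
    · simp [h]
    · obtain ⟨u, hu, hu2, hu3⟩ := exists_seq_strictMono_tendsto' (pos_iff_ne_zero.2 h)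
      have hU : {x | f x < rearr f b} = ⋃ n, {x | f x ≤ u n} := by
        ext x
        simp only [mem_ofPred_eq, mem_iUnion]
        constructor
        · intro hx
          obtain ⟨n, hn⟩ := (hu3.eventually (eventually_gt_nhds hx)).exists
          exact ⟨n, hn.le⟩
        · rintro ⟨n, hn⟩
          exact hn.trans_lt (hu2 n).2
      have hmono : Monotone fun n => {x | f x ≤ u n} := by
        intro i j hij x hx
        simp only [mem_ofPred_eq] at hx ⊢
        exact hx.trans (hu.monotone hij)
      rw [hU, hmono.measure_iUnion]
      refine iSup_le fun n => ?_
      have hlt := (hu2 n).2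
      have hfin : u n ≠ ∞ := hlt.ne_top
      have h1 : ENNReal.ofReal b < leb {x | u n < f x} := by
        rw [← ENNReal.coe_toNNReal hfin] at hlt ⊢
        exact (lt_rearr_iff _ _ _).1 hlt
      have h2 : {x | f x ≤ u n} = {x | u n < f x}ᶜ := by ext x; simp
      rw [h2, prob_compl_eq_one_sub (measurableSet_lt measurable_const hf)]
      gcongr
  have h3 : leb {x | f x < rearr f b} + leb {x | f x < rearr f b}ᶜ = 1 :=
    prob_add_prob_compl (measurableSet_lt hf measurable_const)
  have h4 : {x | f x < rearr f b}ᶜ = {x | rearr f b ≤ f x} := by ext x; simp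
  rw [h4] at h3
  have h5 : (1 - ENNReal.ofReal b) + ENNReal.ofReal b = 1 := tsub_add_cancel_of_le hb1'
  refine (ENNReal.add_le_add_iff_left (a := 1 - ENNReal.ofReal b) (by simp)).1 ?_
  rw [h5]
  exact h3.symm.trans_le (by gcongr)

/-- At the level `l = f*(b)` the set `{f > l}` has measure at most `b` and `{f ≥ l}` at least `b`.
Adding the part of `{f = l}` left of `x₀` interpolates between them continuously in `x₀`. -/
lemma exists_initial_segment {f : ℝ → ℝ≥0∞} (hf : Measurable f) {b : ℝ} (hb1 : b ≤ 1) (hb0 : 0 ≤ b) :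
    ∃ (l : ℝ≥0∞) (x₀ : ℝ), leb ({x | l < f x} ∪ ({x | f x = l} ∩ Iio x₀)) = ENNReal.ofReal b := by
  set l := rearr f b
  refine ⟨l, ?_⟩
  set S : ℝ → Set ℝ := fun x₀ => {x | l < f x} ∪ ({x | f x = l} ∩ Iio x₀) with hS
  have hfin : ∀ A : Set ℝ, leb A ≠ ∞ := fun A => ne_top_of_le_ne_top ENNReal.one_ne_top (leb_le_one A)
  have hcont : Continuous fun x => (leb (S x)).toReal := by
    refine LipschitzWith.continuous (K := 1) (LipschitzWith.of_le_add fun x y => ?_)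
    have hsub : S x ⊆ S y ∪ Ico y x := by
      rintro z (hz | ⟨hz, hzx⟩)
      · exact Or.inl (Or.inl hz)
      · by_cases h : z < y
        · exact Or.inl (Or.inr ⟨hz, h⟩)
        · exact Or.inr ⟨not_lt.1 h, hzx⟩
    have h1 : leb (S x) ≤ leb (S y) + ENNReal.ofReal (dist x y) := by
      refine (measure_mono hsub).trans ((measure_union_le _ _).trans ?_)
      gcongr
      refine (Measure.restrict_apply_le _ _).trans ?_
      rw [Real.volume_Ico]
      exact ENNReal.ofReal_le_ofReal (le_abs_self _)
    have h2 := ENNReal.toReal_mono (ENNReal.add_ne_top.2 ⟨hfin _, by simp⟩) h1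
    rwa [ENNReal.toReal_add (hfin _) (by simp), ENNReal.toReal_ofReal dist_nonneg] at h2
  have h0 : (leb (S 0)).toReal ≤ b := by
    refine ENNReal.toReal_le_of_le_ofReal hb0 ?_
    refine le_trans (le_of_eq ?_) (leb_lt_rearr_at f (b := b))
    refine measure_congr ?_
    filter_upwards [ae_restrict_mem measurableSet_Ioo] with x hx
    change (x ∈ S 0) = (x ∈ {x | l < f x})
    simp [hS, not_lt.2 hx.1.le]
  have h1 : b ≤ (leb (S 1)).toReal := by
    rw [← ENNReal.ofReal_le_iff_le_toReal (hfin _)]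
    refine (le_leb_rearr_at hf hb1).trans (le_of_eq ?_)
    refine measure_congr ?_
    filter_upwards [ae_restrict_mem measurableSet_Ioo] with x hx
    change (x ∈ {x | l ≤ f x}) = (x ∈ S 1)
    simp [hS, hx.2, le_iff_lt_or_eq, eq_comm]
  obtain ⟨x, -, hx⟩ := intermediate_value_Icc zero_le_one hcont.continuousOn ⟨h0, h1⟩
  refine ⟨x, ?_⟩
  change leb (S x) = _
  rw [← ENNReal.ofReal_toReal (hfin (S x))]
  exact congrArg _ hx

/-- A measure preserving transformation along which `f` lies above its decreasing rearrangement. -/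
lemma exists_measurePreserving_rearr_le {f : ℝ → ℝ≥0∞} (hf : Measurable f) :
    ∃ σ : ℝ → ℝ, MeasurePreserving σ leb leb ∧ ∀ x, rearr f (σ x) ≤ f x := by
  -- `D x` is the set of points preceding `x` when points are ordered by decreasing value of `f`,
  -- ties being broken by position. The map `σ` sends `x` to its rank `|D x|`.
  set D : ℝ → Set ℝ := fun x => {y | f x < f y ∨ (f y = f x ∧ y < x)} with hD
  have hfin : ∀ A : Set ℝ, leb A ≠ ∞ := fun A => ne_top_of_le_ne_top ENNReal.one_ne_top (leb_le_one A)
  have hmm : Measurable fun x => leb (D x) := by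
    have h1 : Measurable fun q : ℝ × ℝ => f q.1 := by fun_prop
    have h2 : Measurable fun q : ℝ × ℝ => f q.2 := by fun_prop
    have hR : MeasurableSet {q : ℝ × ℝ | f q.1 < f q.2 ∨ (f q.2 = f q.1 ∧ q.2 < q.1)} :=
      (measurableSet_lt h1 h2).union
        ((measurableSet_eq_fun h2 h1).inter (measurableSet_lt measurable_snd measurable_fst))
    exact measurable_measure_prodMk_left hR
  -- A set `E` of measure `b` that is an initial segment of this order separates the ranks: points
  -- outside have `E ⊆ D x`, points inside have `D x ⊆ E`.
  have key : ∀ b : ℝ, 0 ≤ b → b ≤ 1 → leb {x | leb (D x) < ENNReal.ofReal b} ≤ ENNReal.ofReal b ∧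
      ENNReal.ofReal b ≤ leb {x | leb (D x) ≤ ENNReal.ofReal b} := by
    intro b hb0 hb1
    obtain ⟨l, x₀, hE⟩ := exists_initial_segment hf hb1 hb0
    constructor
    · refine (measure_mono fun x hx => ?_).trans_eq hE
      by_contra hxE
      simp only [mem_ofPred_eq] at hx
      refine absurd hx (not_lt.2 ?_)
      rw [← hE]
      refine measure_mono ?_
      simp only [mem_union, mem_ofPred_eq, mem_inter_iff, mem_Iio, not_or, not_and, not_lt] at hxE
      rintro y (hy | ⟨hy, hyx⟩) <;> simp only [mem_ofPred_eq, mem_Iio, hD] at *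
      · exact Or.inl (hxE.1.trans_lt hy)
      · rcases hxE.1.lt_or_eq with h | h
        · exact Or.inl (hy ▸ h)
        · exact Or.inr ⟨hy.trans h.symm, hyx.trans_le (hxE.2 h)⟩
    · refine hE.symm.trans_le (measure_mono fun x hx => ?_)
      simp only [mem_ofPred_eq]
      rw [← hE]
      refine measure_mono fun y hy => ?_
      simp only [mem_union, mem_ofPred_eq, mem_inter_iff, mem_Iio, hD] at *
      rcases hx with hx | ⟨hx, hxx⟩
      · rcases hy with hy | ⟨hy, -⟩
        · exact Or.inl (hx.trans hy)
        · exact Or.inl (hy ▸ hx)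
      · rcases hy with hy | ⟨hy, hyx⟩
        · exact Or.inl (hx ▸ hy)
        · exact Or.inr ⟨hy.trans hx, hyx.trans hxx⟩
  refine ⟨fun x => (leb (D x)).toReal, ⟨hmm.ennreal_toReal, ?_⟩, ?_⟩
  · have : IsFiniteMeasure (leb.map fun x => (leb (D x)).toReal) :=
      Measure.isFiniteMeasure_map _ _
    refine Measure.ext_of_Iic _ _ fun b => ?_
    rw [Measure.map_apply hmm.ennreal_toReal measurableSet_Iic]
    rcases lt_or_ge b 0 with hb | hb
    · have h1 : (fun x => (leb (D x)).toReal) ⁻¹' Iic b = ∅ := by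
        ext x; simp [hb.trans_le ENNReal.toReal_nonneg]
      have h2 : Iic b ∩ Ioo 0 1 = (∅ : Set ℝ) := by
        ext x; simp; intro h h'; linarith
      rw [h1, measure_empty, Measure.restrict_apply' measurableSet_Ioo, h2, measure_empty]
    rcases lt_or_ge b 1 with hb1 | hb1
    · have h1 : (fun x => (leb (D x)).toReal) ⁻¹' Iic b = {x | leb (D x) ≤ ENNReal.ofReal b} := by
        ext x
        simp only [mem_preimage, mem_Iic, mem_ofPred_eq]
        exact (ENNReal.le_ofReal_iff_toReal_le (hfin _) hb).symm
      have h2 : leb (Iic b) = ENNReal.ofReal b := by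
        have : Iic b ∩ Ioo 0 1 = Ioc 0 b := by
          ext x; simp only [mem_inter_iff, mem_Iic, mem_Ioo, mem_Ioc]
          constructor
          · rintro ⟨h, h', -⟩; exact ⟨h', h⟩
          · rintro ⟨h, h'⟩; exact ⟨h', h, h'.trans_lt hb1⟩
        rw [Measure.restrict_apply' measurableSet_Ioo, this]; simp
      rw [h1, h2]
      refine le_antisymm ?_ (key b hb hb1.le).2
      refine le_of_forall_gt_imp_ge_of_dense fun a ha => ?_
      rcases le_or_gt 1 a with h | h
      · exact (leb_le_one _).trans h
      have ha' : a = ENNReal.ofReal a.toReal := (ENNReal.ofReal_toReal h.ne_top).symm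
      have hk := (key a.toReal ENNReal.toReal_nonneg (by simpa using ENNReal.toReal_mono ENNReal.one_ne_top h.le)).1
      rw [← ha'] at hk
      refine (measure_mono fun x hx => ?_).trans hk
      simp only [mem_ofPred_eq] at *
      exact hx.trans_lt ha
    · have h1 : (fun x => (leb (D x)).toReal) ⁻¹' Iic b = univ := by
        ext x
        simp only [mem_preimage, mem_Iic, mem_univ, iff_true]
        refine le_trans ?_ hb1
        simpa using ENNReal.toReal_mono ENNReal.one_ne_top (leb_le_one (D x))
      have h2 : Iic b ∩ Ioo 0 1 = Ioo 0 1 := inter_eq_right.2 fun x hx => hx.2.le.trans hb1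
      rw [h1, leb_univ, Measure.restrict_apply' measurableSet_Ioo, h2]; simp
  · intro x
    refine le_of_forall_lt_imp_le_of_dense fun a ha => ?_
    obtain ⟨d, hd1, hd2⟩ := ENNReal.lt_iff_exists_nnreal_btwn.1 ha
    refine hd1.le.trans ?_
    by_contra hcon
    push Not at hcon
    rw [lt_rearr_iff, ENNReal.ofReal_toReal (hfin _)] at hd2
    -- If `f x < d`, all points where `f > d` precede `x`, so their measure cannot exceed the rank
    -- of `x`.
    refine absurd hd2 (not_lt.2 (measure_mono fun y hy => ?_))
    exact Or.inl (hcon.trans hy)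


/-! ### Associate norms, the Lorentz–Luxemburg theorem and Minkowski's inequality -/

lemma iSup_min_natCast (a : ℝ≥0∞) : ⨆ n : ℕ, min a (n : ℝ≥0∞) = a := by
  have := inf_iSup_eq a (fun n : ℕ => (n : ℝ≥0∞))
  rw [ENNReal.iSup_natCast, inf_top_eq] at this
  exact this.symm

lemma lintegral_mul_eq_iSup_min {f w : ℝ → ℝ≥0∞} {μ : Measure ℝ} (hf : AEMeasurable f μ)
    (hw : AEMeasurable w μ) :
    ∫⁻ x, f x * w x ∂μ = ⨆ n : ℕ, ∫⁻ x, min (f x) (n : ℝ≥0∞) * w x ∂μ := by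
  rw [← lintegral_iSup']
  · refine lintegral_congr fun x => ?_
    rw [← ENNReal.iSup_mul, iSup_min_natCast]
  · intro n
    exact (hf.min aemeasurable_const).mul hw
  · refine Eventually.of_forall fun x i j hij => ?_
    dsimp only
    gcongr

namespace RIFunctionNorm
variable (X : RIFunctionNorm)

/-- Fatou's lemma without monotonicity: the tail infima increase to the limit and lie below the
given functions. -/
lemma norm_le_of_tendsto {f : ℕ → ℝ → ℝ≥0∞} {F : ℝ → ℝ≥0∞} {K : ℝ≥0∞} (hf : ∀ n, MPlus (f n))
    (hF : MPlus F) (hlim : ∀ᵐ x ∂leb, Tendsto (fun n => f n x) atTop (𝓝 (F x)))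
    (hK : ∀ n, X.norm (f n) ≤ K) : X.norm F ≤ K := by
  have hm : ∀ n, MPlus (fun x => ⨅ i, f (i + n) x) := fun n =>
    AEMeasurable.iInf fun i => hf (i + n)
  refine le_of_tendsto' (X.norm_fatou (fun n x => ⨅ i, f (i + n) x) F hm hF ?_) fun n => ?_
  · filter_upwards [hlim] with x hx
    have hmono : Monotone fun n => ⨅ i, f (i + n) x := by
      intro a b hab
      refine le_iInf fun i => ?_
      refine (iInf_le _ (i + (b - a))).trans_eq ?_
      exact congrArg (fun j => f j x) (by omega)
    refine ⟨hmono, ?_⟩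
    have := tendsto_atTop_iSup hmono
    have hl := liminf_eq_iSup_iInf_of_nat' (u := fun n => f n x)
    rw [hx.liminf_eq] at hl
    rwa [← hl] at this
  · refine le_trans (X.norm_mono _ _ (hm n) (hf n) (Eventually.of_forall fun x => ?_)) (hK n)
    exact (iInf_le _ 0).trans_eq (by rw [zero_add])

lemma norm_smul_le {f : ℝ → ℝ≥0∞} (hf : MPlus f) (c : ℝ≥0∞) :
    X.norm (fun x => c * f x) ≤ c * X.norm f := by
  rcases eq_or_ne c ∞ with rfl | hc
  · rcases eq_or_ne (X.norm f) 0 with h | h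
    · have h0 := (X.norm_eq_zero_iff f hf).1 h
      rw [h, mul_zero, nonpos_iff_eq_zero, X.norm_eq_zero_iff _ (hf.const_mul _)]
      filter_upwards [h0] with x hx
      simp [hx]
    · rw [ENNReal.top_mul h]; exact le_top
  · lift c to ℝ≥0 using hc
    exact (X.norm_smul f hf c).le

lemma lintegral_mul_le_norm {f η : ℝ → ℝ≥0∞} (hf : MPlus f) (hη : assoc X.norm η ≤ 1) :
    ∫⁻ x, f x * η x ∂leb ≤ X.norm f := by
  rcases eq_or_ne (X.norm f) 0 with h | h
  · have h0 := (X.norm_eq_zero_iff f hf).1 h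
    rw [lintegral_congr_ae (g := fun _ => 0) (by filter_upwards [h0] with x hx; simp [hx])]
    simp
  rcases eq_or_ne (X.norm f) ∞ with h' | h'
  · rw [h']; exact le_top
  have hle : ∫⁻ x, (X.norm f)⁻¹ * f x * η x ∂leb ≤ 1 := by
    refine le_trans ?_ hη
    refine le_iSup_of_le (fun x => (X.norm f)⁻¹ * f x) (le_iSup_of_le (hf.const_mul _)
      (le_iSup_of_le ?_ le_rfl))
    refine (X.norm_smul_le hf _).trans_eq (ENNReal.inv_mul_cancel h h')
  simp_rw [mul_assoc] at hle
  rw [lintegral_const_mul' _ _ (by simpa using h)] at hle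
  calc _ = X.norm f * ((X.norm f)⁻¹ * ∫⁻ x, f x * η x ∂leb) := by
        rw [← mul_assoc, ENNReal.mul_inv_cancel h h', one_mul]
    _ ≤ X.norm f * 1 := by gcongr
    _ = _ := mul_one _

lemma norm_zero : X.norm (fun _ => 0) = 0 :=
  (X.norm_eq_zero_iff _ aemeasurable_const).2 (Eventually.of_forall fun _ => rfl)

/-- The unit ball of a function norm inside the Hilbert space `L²(0,1)`. -/
def l2Ball : Set (Lp ℝ 2 leb) := {F | X.norm (fun x => ENNReal.ofReal (F x)) ≤ 1}

lemma mplus_ofReal_coe (F : Lp ℝ 2 leb) : MPlus fun x => ENNReal.ofReal (F x) :=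
  (Lp.aestronglyMeasurable F).aemeasurable.ennreal_ofReal

lemma convex_l2Ball : Convex ℝ X.l2Ball := by
  intro F hF G hG a b ha hb hab
  simp only [l2Ball, mem_ofPred_eq] at hF hG ⊢
  have hmF := mplus_ofReal_coe F
  have hmG := mplus_ofReal_coe G
  calc X.norm (fun x => ENNReal.ofReal ((a • F + b • G : Lp ℝ 2 leb) x))
      ≤ X.norm (fun x => ENNReal.ofReal a * ENNReal.ofReal (F x)
          + ENNReal.ofReal b * ENNReal.ofReal (G x)) := by
        refine X.norm_mono _ _ (mplus_ofReal_coe _) ((hmF.const_mul _).add (hmG.const_mul _)) ?_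
        filter_upwards [Lp.coeFn_add (a • F) (b • G), Lp.coeFn_smul a F, Lp.coeFn_smul b G]
          with x h1 h2 h3
        rw [h1, Pi.add_apply, h2, h3, Pi.smul_apply, Pi.smul_apply, smul_eq_mul, smul_eq_mul,
          ← ENNReal.ofReal_mul ha, ← ENNReal.ofReal_mul hb]
        exact ENNReal.ofReal_add_le
    _ ≤ _ := X.norm_add_le _ _ (hmF.const_mul _) (hmG.const_mul _)
    _ ≤ ENNReal.ofReal a * 1 + ENNReal.ofReal b * 1 := by
        refine add_le_add ((X.norm_smul_le hmF _).trans ?_) ((X.norm_smul_le hmG _).trans ?_) <;>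
          gcongr
    _ = 1 := by rw [mul_one, mul_one, ← ENNReal.ofReal_add ha hb, hab, ENNReal.ofReal_one]

/-- An `L²`-convergent sequence has an a.e. convergent subsequence, to which the Fatou property
applies. -/
lemma isClosed_l2Ball : IsClosed X.l2Ball := by
  refine IsSeqClosed.isClosed fun u F hu hF => ?_
  obtain ⟨ns, -, hns⟩ := (tendstoInMeasure_of_tendsto_Lp hF).exists_seq_tendsto_ae
  refine X.norm_le_of_tendsto (f := fun n x => ENNReal.ofReal (u (ns n) x))
    (fun n => mplus_ofReal_coe _) (mplus_ofReal_coe _) ?_ fun n => hu (ns n)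
  filter_upwards [hns] with x hx
  exact ENNReal.tendsto_ofReal hx

/-- Separation of a bounded function from the unit ball. -/
lemma exists_assoc_le_one_lt_lintegral {g : ℝ → ℝ≥0∞} (hg : Measurable g) {n : ℝ≥0}
    (hb : ∀ x, g x ≤ n) (h1 : 1 < X.norm g) :
    ∃ η, Measurable η ∧ assoc X.norm η ≤ 1 ∧ 1 < ∫⁻ x, g x * η x ∂leb := by
  classical
  have hmem : ∀ {b : ℝ → ℝ} {k : ℝ≥0}, Measurable b → (∀ x, ‖b x‖ ≤ k) → MemLp b 2 leb :=
    fun hbm hbk => MemLp.of_bound hbm.aestronglyMeasurable _ (Eventually.of_forall hbk)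
  have hgm : MemLp (fun x => (g x).toReal) 2 leb := by
    refine hmem (k := n) hg.ennreal_toReal fun x => ?_
    rw [Real.norm_of_nonneg ENNReal.toReal_nonneg]
    exact ENNReal.toReal_le_of_le_ofReal n.2 (by simpa using hb x)
  have hgfin : ∀ x, g x ≠ ∞ := fun x => ne_top_of_le_ne_top ENNReal.coe_ne_top (hb x)
  set G : Lp ℝ 2 leb := hgm.toLp _ with hG
  have hGcoe := hgm.coeFn_toLp
  have h0mem : (0 : Lp ℝ 2 leb) ∈ X.l2Ball := by
    have : X.norm (fun x => ENNReal.ofReal ((0 : Lp ℝ 2 leb) x)) = X.norm (fun _ => 0) := by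
      refine X.norm_congr (mplus_ofReal_coe _) ?_
      filter_upwards [Lp.coeFn_zero ℝ 2 leb] with x hx
      rw [hx]; simp
    simp only [l2Ball, mem_ofPred_eq]
    rw [this, X.norm_zero]; exact zero_le
  have hGnot : G ∉ X.l2Ball := by
    have : X.norm (fun x => ENNReal.ofReal (G x)) = X.norm g := by
      refine X.norm_congr (mplus_ofReal_coe _) ?_
      filter_upwards [hGcoe] with x hx
      rw [hx, ENNReal.ofReal_toReal (hgfin x)]
    simp only [l2Ball, mem_ofPred_eq, this, not_le]
    exact h1
  -- Separation by projection: `z` is the point of the ball nearest to `G`, and `W = G - z` is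
  -- normal to a separating hyperplane.
  obtain ⟨z, hzB, hz⟩ := exists_norm_eq_iInf_of_complete_convex ⟨0, h0mem⟩
    X.isClosed_l2Ball.isComplete X.convex_l2Ball G
  rw [norm_eq_iInf_iff_real_inner_le_zero X.convex_l2Ball hzB] at hz
  set W : Lp ℝ 2 leb := G - z with hW
  have hWne : W ≠ 0 := by
    intro h
    rw [hW, sub_eq_zero] at h
    exact hGnot (h ▸ hzB)
  set c : ℝ := inner ℝ W z with hc
  have hWb : ∀ b ∈ X.l2Ball, inner ℝ W b ≤ c := by
    intro b hbB
    have := hz b hbB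
    rw [inner_sub_right] at this
    linarith
  have hc0 : 0 ≤ c := by simpa using hWb 0 h0mem
  have hcG : c < inner ℝ W G := by
    have h2 : inner ℝ W W = inner ℝ W G - c := by rw [hc, ← inner_sub_right]
    have h3 : 0 < inner ℝ W W := real_inner_self_pos.2 hWne
    linarith
  -- The functional will be `η = W⁺ / d`. Any `d` strictly between the bound `c` on the ball and the
  -- value at `G` works; it is positive because the ball contains `0`.
  obtain ⟨d, hd1, hd2⟩ := exists_between hcG
  have hd0 : 0 < d := hc0.trans_lt hd1
  have hWmeas : Measurable (W : ℝ → ℝ) := (Lp.stronglyMeasurable W).measurable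
  have hbdd : ∀ (b : ℝ → ℝ≥0∞) (k : ℝ≥0), Measurable b → (∀ x, b x ≤ k) → X.norm b ≤ 1 →
      ∫⁻ x, b x * ENNReal.ofReal (W x) ∂leb ≤ ENNReal.ofReal c := by
    intro b k hbm hbk hbn
    -- Cutting `b` off where `W ≤ 0` keeps it in the ball, so the bound `c` for `W` also holds for
    -- `W⁺`.
    set b' : ℝ → ℝ := fun x => if 0 < W x then (b x).toReal else 0 with hb'
    have hb'm : Measurable b' :=
      Measurable.ite (measurableSet_lt measurable_const hWmeas) hbm.ennreal_toReal measurable_const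
    have hb'mem : MemLp b' 2 leb := by
      refine hmem (k := k) hb'm fun x => ?_
      simp only [hb']
      split_ifs
      · rw [Real.norm_of_nonneg ENNReal.toReal_nonneg]
        exact ENNReal.toReal_le_of_le_ofReal k.2 (by simpa using hbk x)
      · simp
    have hmemB : hb'mem.toLp _ ∈ X.l2Ball := by
      refine le_trans (X.norm_mono _ _ (mplus_ofReal_coe _) hbm.aemeasurable ?_) hbn
      filter_upwards [hb'mem.coeFn_toLp] with x hx
      rw [hx]
      simp only [hb']
      split_ifs
      · exact ENNReal.ofReal_toReal_le
      · simp
    have hin := hWb _ hmemB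
    rw [L2.inner_def] at hin
    have hcongr : (fun x => inner ℝ (W x) (hb'mem.toLp _ x)) =ᵐ[leb] fun x => b' x * W x := by
      filter_upwards [hb'mem.coeFn_toLp] with x hx
      rw [hx]; simp
    rw [integral_congr_ae hcongr] at hin
    have hint : Integrable (fun x => b' x * W x) leb :=
      (L2.integrable_inner (𝕜 := ℝ) W (hb'mem.toLp _)).congr hcongr
    have hnn : ∀ x, 0 ≤ b' x * W x := by
      intro x; simp only [hb']
      split_ifs with h
      · exact mul_nonneg ENNReal.toReal_nonneg h.le
      · simp
    calc ∫⁻ x, b x * ENNReal.ofReal (W x) ∂leb = ∫⁻ x, ENNReal.ofReal (b' x * W x) ∂leb := by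
          refine lintegral_congr fun x => ?_
          simp only [hb']
          split_ifs with h
          · rw [ENNReal.ofReal_mul ENNReal.toReal_nonneg,
              ENNReal.ofReal_toReal (ne_top_of_le_ne_top ENNReal.coe_ne_top (hbk x))]
          · simp [ENNReal.ofReal_of_nonpos (not_lt.1 h)]
      _ = ENNReal.ofReal (∫ x, b' x * W x ∂leb) :=
          (ofReal_integral_eq_lintegral_ofReal hint (Eventually.of_forall hnn)).symm
      _ ≤ _ := ENNReal.ofReal_le_ofReal hin
  have hηm : Measurable fun x => ENNReal.ofReal (W x) / ENNReal.ofReal d :=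
    hWmeas.ennreal_ofReal.div_const _
  refine ⟨_, hηm, ?_, ?_⟩
  · refine iSup_le fun f => iSup_le fun hf => iSup_le fun hf1 => ?_
    obtain ⟨f', hf'm, hff'⟩ := hf
    have hn' : X.norm f' ≤ 1 := by rwa [← X.norm_congr ⟨f', hf'm, hff'⟩ hff']
    have : ∫⁻ x, f x * ENNReal.ofReal (W x) ∂leb ≤ ENNReal.ofReal d := by
      rw [lintegral_congr_ae (g := fun x => f' x * ENNReal.ofReal (W x))
        (by filter_upwards [hff'] with x hx; rw [hx]),
        lintegral_mul_eq_iSup_min hf'm.aemeasurable hWmeas.ennreal_ofReal.aemeasurable]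
      refine iSup_le fun j => (hbdd _ j (hf'm.min measurable_const) (fun x => ?_) ?_).trans
        (ENNReal.ofReal_le_ofReal hd1.le)
      · simp
      · exact (X.norm_mono _ _ (hf'm.min measurable_const).aemeasurable hf'm.aemeasurable
          (Eventually.of_forall fun x => min_le_left _ _)).trans hn'
    simp_rw [← mul_div_assoc, div_eq_mul_inv]
    rw [lintegral_mul_const' _ _ (by simpa using hd0), ← div_eq_mul_inv]
    exact ENNReal.div_le_of_le_mul (by rwa [one_mul])
  · simp_rw [← mul_div_assoc, div_eq_mul_inv]
    rw [lintegral_mul_const' _ _ (by simpa using hd0), ← div_eq_mul_inv,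
      ENNReal.lt_div_iff_mul_lt (Or.inl (by simpa using hd0)) (Or.inl ENNReal.ofReal_ne_top), one_mul]
    have hcongr : (fun x => inner ℝ (W x) (G x)) =ᵐ[leb] fun x => (g x).toReal * W x := by
      filter_upwards [hGcoe] with x hx
      rw [hx]; simp
    have hint : Integrable (fun x => (g x).toReal * W x) leb :=
      (L2.integrable_inner (𝕜 := ℝ) W G).congr hcongr
    rw [L2.inner_def, integral_congr_ae hcongr] at hd2
    have hint' : Integrable (fun x => (g x).toReal * max (W x) 0) leb := by
      refine hint.pos_part.congr (Eventually.of_forall fun x => ?_)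
      dsimp only
      rw [mul_max_of_nonneg _ _ ENNReal.toReal_nonneg, mul_zero]
    calc ENNReal.ofReal d < ENNReal.ofReal (∫ x, (g x).toReal * max (W x) 0 ∂leb) := by
          refine (ENNReal.ofReal_lt_ofReal_iff_of_nonneg hd0.le).2 (hd2.trans_le ?_)
          refine integral_mono hint hint' fun x => ?_
          exact mul_le_mul_of_nonneg_left (le_max_left _ _) ENNReal.toReal_nonneg
      _ = ∫⁻ x, ENNReal.ofReal ((g x).toReal * max (W x) 0) ∂leb :=
          ofReal_integral_eq_lintegral_ofReal hint' (Eventually.of_forall fun x =>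
            mul_nonneg ENNReal.toReal_nonneg (le_max_right _ _))
      _ = _ := by
          refine lintegral_congr fun x => ?_
          rw [ENNReal.ofReal_mul ENNReal.toReal_nonneg, ENNReal.ofReal_toReal (hgfin x)]
          congr 1
          rcases le_total (W x) 0 with h | h
          · rw [max_eq_right h, ENNReal.ofReal_zero, ENNReal.ofReal_of_nonpos h]
          · rw [max_eq_left h]

/-- The Lorentz–Luxemburg theorem: a function norm is the second associate of itself. -/
lemma norm_le_of_forall_assoc {g : ℝ → ℝ≥0∞} (hg : Measurable g) {K : ℝ≥0∞}
    (h : ∀ η, Measurable η → assoc X.norm η ≤ 1 → ∫⁻ x, g x * η x ∂leb ≤ K) : X.norm g ≤ K := by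
  have htr : ∀ n : ℕ, X.norm (fun x => min (g x) (n : ℝ≥0∞)) ≤ K := by
    intro n
    by_contra hcon
    push Not at hcon
    obtain ⟨d, hd1, hd2⟩ := ENNReal.lt_iff_exists_nnreal_btwn.1 hcon
    have hd0 : (d : ℝ≥0∞) ≠ 0 := (zero_le.trans_lt hd1).ne'
    have hd0' : d ≠ 0 := by exact_mod_cast hd0
    have hm : Measurable fun x => min (g x) (n : ℝ≥0∞) := hg.min measurable_const
    -- The truncation is bounded, hence in `L²`. Dividing by a `d` strictly between `K` and its norm
    -- puts it just outside the unit ball.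
    obtain ⟨η, hη, hη1, hη2⟩ := X.exists_assoc_le_one_lt_lintegral
      (g := fun x => ((d⁻¹ : ℝ≥0) : ℝ≥0∞) * min (g x) (n : ℝ≥0∞)) (hm.const_mul _) (n := d⁻¹ * n)
      (fun x => by
        push_cast
        gcongr
        exact min_le_right _ _)
      (by
        rw [X.norm_smul _ hm.aemeasurable, ENNReal.coe_inv hd0', mul_comm, ← div_eq_mul_inv,
          ENNReal.lt_div_iff_mul_lt (Or.inl hd0) (Or.inl ENNReal.coe_ne_top), one_mul]
        exact hd2)
    refine absurd hη2 (not_lt.2 ?_)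
    simp_rw [mul_assoc]
    rw [lintegral_const_mul' _ _ ENNReal.coe_ne_top, ENNReal.coe_inv hd0', mul_comm,
      ← div_eq_mul_inv]
    refine ENNReal.div_le_of_le_mul ?_
    rw [one_mul]
    refine le_trans (lintegral_mono fun x => ?_) ((h η hη hη1).trans hd1.le)
    gcongr
    exact min_le_left _ _
  refine X.norm_le_of_tendsto (f := fun n x => min (g x) (n : ℝ≥0∞))
    (fun n => (hg.min measurable_const).aemeasurable) hg.aemeasurable ?_ htr
  refine Eventually.of_forall fun x => ?_
  have hmono : Monotone fun n : ℕ => min (g x) (n : ℝ≥0∞) := by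
    intro i j hij
    dsimp only
    gcongr
  have := tendsto_atTop_iSup hmono
  rwa [iSup_min_natCast] at this

/-- Minkowski's integral inequality. -/
lemma norm_lintegral_le {F : ℝ → ℝ → ℝ≥0∞} (hF : Measurable (Function.uncurry F)) {S : Set ℝ}
    (hS : MeasurableSet S) {K : ℝ≥0∞} (hK : ∀ l ∈ S, X.norm (F l) ≤ K) :
    X.norm (fun x => ∫⁻ l in S, F l x) ≤ K * volume S := by
  have hF' : Measurable (Function.uncurry fun x l => F l x) := hF.comp measurable_swap
  refine X.norm_le_of_forall_assoc (Measurable.lintegral_prod_right' hF') fun η hη hη1 => ?_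
  have hm : ∀ x, Measurable fun l => F l x := fun x => hF.comp (by fun_prop : Measurable fun l : ℝ => (l, x))
  have hm' : ∀ l, Measurable (F l) := fun l => hF.comp (by fun_prop : Measurable fun x : ℝ => (l, x))
  calc ∫⁻ x, (∫⁻ l in S, F l x) * η x ∂leb = ∫⁻ x, (∫⁻ l in S, F l x * η x) ∂leb := by
        refine lintegral_congr fun x => ?_
        rw [lintegral_mul_const _ (hm x)]
    _ = ∫⁻ l in S, ∫⁻ x, F l x * η x ∂leb := by
        refine lintegral_lintegral_swap ?_
        exact (hF'.mul (hη.comp measurable_fst)).aemeasurable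
    _ ≤ ∫⁻ l in S, K := by
        refine setLIntegral_mono' hS fun l hl => ?_
        exact (X.lintegral_mul_le_norm (hm' l).aemeasurable hη1).trans (hK l hl)
    _ = K * volume S := by simp

end RIFunctionNorm

namespace RIFunctionNorm
variable (X : RIFunctionNorm)

/-- The factor `a` may be infinite, so homogeneity is applied to `min a n` before taking the
supremum. -/
lemma mul_norm_le_norm {h f : ℝ → ℝ≥0∞} (hh : MPlus h) (hf : MPlus f) {a : ℝ≥0∞}
    (hle : ∀ᵐ x ∂leb, a * h x ≤ f x) : a * X.norm h ≤ X.norm f := by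
  rw [← iSup_min_natCast a, ENNReal.iSup_mul]
  refine iSup_le fun n => ?_
  have hfin : min a (n : ℝ≥0∞) ≠ ∞ := ne_top_of_le_ne_top (ENNReal.natCast_ne_top n) (min_le_right _ _)
  lift min a (n : ℝ≥0∞) to ℝ≥0 using hfin with c hc
  rw [← X.norm_smul h hh]
  refine X.norm_mono _ _ (hh.const_mul _) hf ?_
  filter_upwards [hle] with x hx
  refine le_trans ?_ hx
  rw [hc]
  gcongr
  exact min_le_left _ _

end RIFunctionNorm

/-! ### The fundamental function -/

lemma measurable_indicator_one (t : ℝ) : Measurable ((Ioo 0 t).indicator fun _ => (1 : ℝ≥0∞)) :=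
  measurable_const.indicator measurableSet_Ioo

lemma leb_Ioo {t : ℝ} (ht : t ≤ 1) : leb (Ioo 0 t) = ENNReal.ofReal t := by
  rw [Measure.restrict_apply' measurableSet_Ioo, inter_eq_left.2 (Ioo_subset_Ioo_right ht)]
  simp

lemma setOf_lt_indicator_one (t : ℝ) (c : ℝ≥0) :
    {x | (c : ℝ≥0∞) < (Ioo 0 t).indicator (fun _ => (1 : ℝ≥0∞)) x} = if c < 1 then Ioo 0 t else ∅ := by
  ext x
  simp only [mem_ofPred_eq, indicator_apply]
  split_ifs with h1 h2 h2 <;> simp_all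

section fundamental
variable (X : RIFunctionNorm) {s t : ℝ}

lemma fundamental_mono (hst : s ≤ t) : fundamental X s ≤ fundamental X t := by
  refine X.norm_mono _ _ (measurable_indicator_one s).aemeasurable
    (measurable_indicator_one t).aemeasurable (Eventually.of_forall ?_)
  exact indicator_le_indicator_of_subset (Ioo_subset_Ioo_right hst) (fun _ => zero_le)

lemma fundamental_le_two_mul (ht : t ≤ 1) :
    fundamental X t ≤ 2 * fundamental X (t / 2) := by
  refine X.norm_le_two_mul_of_dist_le (measurable_indicator_one t).aemeasurable
    (measurable_indicator_one _).aemeasurable fun c => ?_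
  rw [setOf_lt_indicator_one, setOf_lt_indicator_one]
  split_ifs
  · rw [leb_Ioo ht, leb_Ioo (by linarith)]
    have : (2 : ℝ≥0∞) = ENNReal.ofReal 2 := by simp
    rw [this, ← ENNReal.ofReal_mul (by norm_num)]
    exact ENNReal.ofReal_le_ofReal (by linarith)
  · simp

lemma fundamental_pos (ht0 : 0 < t) : fundamental X t ≠ 0 := by
  intro h
  have h1 := (X.norm_eq_zero_iff _ (measurable_indicator_one t).aemeasurable).1 h
  have h2 : leb (Ioo 0 t) = 0 := by
    refine measure_mono_null ?_ h1
    intro x hx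
    change ¬ (Ioo 0 t).indicator (fun _ => (1 : ℝ≥0∞)) x = 0
    simp [indicator_of_mem hx]
  have h3 : leb (Ioo 0 (min t 1)) = 0 :=
    measure_mono_null (Ioo_subset_Ioo_right (min_le_left _ _)) h2
  rw [leb_Ioo (min_le_right _ _)] at h3
  simp at h3
  linarith

lemma fundamental_le_norm_one : fundamental X t ≤ X.norm fun _ => 1 := by
  refine X.norm_mono _ _ (measurable_indicator_one t).aemeasurable aemeasurable_const
    (Eventually.of_forall fun x => ?_)
  exact indicator_le_self' (fun _ _ => zero_le) x

lemma fundamental_ne_top : fundamental X t ≠ ∞ :=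
  ((fundamental_le_norm_one X).trans_lt X.norm_one_lt_top).ne

lemma mul_fundamental_le {U : ℝ → ℝ≥0∞} (hU : MPlus U) {a : ℝ≥0∞}
    (h : ∀ x ∈ Ioo 0 t, a ≤ U x) : a * fundamental X t ≤ X.norm U := by
  refine X.mul_norm_le_norm (measurable_indicator_one t).aemeasurable hU
    (Eventually.of_forall fun x => ?_)
  by_cases hx : x ∈ Ioo 0 t
  · simpa [hx] using h x hx
  · simp [hx]

/-- Let `G = g*χ_(0,t)`. For `x` in `(0,t)`, the translates `G(x + y)` integrated over `y` in
`(-t,t)` recover all of `∫_0^t g*`. Each translate has norm at most that of `g`, so Minkowski's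
inequality bounds the integral by `2t‖g‖`. -/
lemma maxRearr_mul_fundamental_le {g : ℝ → ℝ≥0∞} (hg : MPlus g) (ht : t ∈ Ioo (0 : ℝ) 1) :
    maxRearr g t * fundamental X t ≤ 2 * X.norm g := by
  set G : ℝ → ℝ≥0∞ := (Ioo 0 t).indicator (rearr g) with hGdef
  have hG : Measurable G := (measurable_rearr g).indicator measurableSet_Ioo
  have hF : Measurable (Function.uncurry fun y x : ℝ => G (x + y)) :=
    hG.comp (by fun_prop : Measurable fun q : ℝ × ℝ => q.2 + q.1)
  have hFm : ∀ y, Measurable fun x => G (x + y) := fun y => hG.comp (by fun_prop)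
  have hn : ∀ y, X.norm (fun x => G (x + y)) ≤ X.norm g := by
    intro y
    refine X.norm_le_of_dist_le (hFm y).aemeasurable hg fun c => ?_
    have hsub : {x | (c : ℝ≥0∞) < G x} ⊆ Ioo 0 1 := by
      intro x hx
      by_contra h
      have : x ∉ Ioo 0 t := fun h' => h (Ioo_subset_Ioo_right ht.2.le h')
      simp [hGdef, this] at hx
    calc leb {x | (c : ℝ≥0∞) < G (x + y)} ≤ volume ((fun x => x + y) ⁻¹' {x | (c : ℝ≥0∞) < G x}) :=
          Measure.restrict_apply_le _ _
      _ = leb {x | (c : ℝ≥0∞) < G x} := by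
          rw [measure_preimage_add_right, Measure.restrict_apply' measurableSet_Ioo,
            inter_eq_left.2 hsub]
      _ ≤ leb {x | (c : ℝ≥0∞) < rearr g x} := by
          refine measure_mono fun x hx => ?_
          simp only [mem_ofPred_eq] at *
          exact hx.trans_le (indicator_le_self' (fun _ _ => zero_le) x)
      _ = _ := leb_lt_rearr g c
  have hM := X.norm_lintegral_le hF (S := Ioo (-t) t) measurableSet_Ioo fun y _ => hn y
  have hmm : Measurable fun x : ℝ => ∫⁻ y in Ioo (-t) t, G (x + y) := by
    have hF' : Measurable (Function.uncurry fun x y : ℝ => G (x + y)) :=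
      hG.comp (by fun_prop : Measurable fun q : ℝ × ℝ => q.1 + q.2)
    exact Measurable.lintegral_prod_right' hF'
  have hJ := mul_fundamental_le X (t := t) hmm.aemeasurable (a := ∫⁻ r in Ioo 0 t, rearr g r) (by
    intro x hx
    rw [← lintegral_indicator measurableSet_Ioo, ← lintegral_add_left_eq_self _ x,
      ← lintegral_indicator measurableSet_Ioo]
    refine lintegral_mono fun y => ?_
    change G (x + y) ≤ _
    by_cases hy : y ∈ Ioo (-t) t
    · simp [hy]
    · have : x + y ∉ Ioo 0 t := by
        intro h
        refine hy ⟨?_, ?_⟩ <;> linarith [h.1, h.2, hx.1, hx.2]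
      simp [hGdef, this])
  have hvol : volume (Ioo (-t) t) = 2 * ENNReal.ofReal t := by
    rw [Real.volume_Ioo, show t - -t = 2 * t by ring, ENNReal.ofReal_mul (by norm_num)]; simp
  rw [hvol] at hM
  have ht0 : ENNReal.ofReal t ≠ 0 := by simpa using ht.1
  calc maxRearr g t * fundamental X t
      = (ENNReal.ofReal t)⁻¹ * ((∫⁻ r in Ioo 0 t, rearr g r) * fundamental X t) := by
        rw [maxRearr, mul_assoc]
    _ ≤ (ENNReal.ofReal t)⁻¹ * (X.norm g * (2 * ENNReal.ofReal t)) := by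
        exact mul_le_mul_right (hJ.trans hM) _
    _ = ((ENNReal.ofReal t)⁻¹ * ENNReal.ofReal t) * (2 * X.norm g) := by ring
    _ = _ := by rw [ENNReal.inv_mul_cancel ht0 ENNReal.ofReal_ne_top, one_mul]

end fundamental

lemma rearr_le_maxRearr (g : ℝ → ℝ≥0∞) {t : ℝ} (ht : 0 < t) : rearr g t ≤ maxRearr g t := by
  have ht0 : ENNReal.ofReal t ≠ 0 := by simpa using ht
  calc rearr g t = (ENNReal.ofReal t)⁻¹ * (rearr g t * ENNReal.ofReal t) := by
        rw [mul_comm (rearr g t), ← mul_assoc, ENNReal.inv_mul_cancel ht0 ENNReal.ofReal_ne_top, one_mul]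
    _ = (ENNReal.ofReal t)⁻¹ * ∫⁻ r in Ioo 0 t, rearr g t := by simp
    _ ≤ _ := by
        rw [maxRearr]
        exact mul_le_mul_right (setLIntegral_mono' measurableSet_Ioo
          fun r hr => rearr_antitone g hr.2.le) _

/-! ### The measure with density `1/I` -/

/-- The function `1 / I` on `(0,1)`, extended by zero. -/
noncomputable def dens (I : ℝ → ℝ) : ℝ → ℝ≥0∞ := (Ioo 0 1).indicator fun r => (ENNReal.ofReal (I r))⁻¹

/-- The integral of `1 / I` over `(s, t) ∩ (0, 1)`. -/
noncomputable def densInt (I : ℝ → ℝ) (s t : ℝ) : ℝ≥0∞ := ∫⁻ r in Ioo s t, dens I r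

section dens
variable {I : ℝ → ℝ}

lemma dens_of_mem {t : ℝ} (ht : t ∈ Ioo (0 : ℝ) 1) : dens I t = (ENNReal.ofReal (I t))⁻¹ := by
  simp [dens, ht]

lemma dens_of_notMem {t : ℝ} (ht : t ∉ Ioo (0 : ℝ) 1) : dens I t = 0 := by
  simp [dens, ht]

lemma invInt_eq_densInt {s t : ℝ} (hs : 0 ≤ s) (ht : t ≤ 1) : invInt I s t = densInt I s t :=
  setLIntegral_congr_fun measurableSet_Ioo fun _ hr =>
    (dens_of_mem ⟨hs.trans_lt hr.1, hr.2.trans_le ht⟩).symm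

lemma dens_antitoneOn (hI : MonotoneOn I (Ioo 0 1)) : AntitoneOn (dens I) (Ioo 0 1) := by
  intro s hs t ht hst
  rw [dens_of_mem hs, dens_of_mem ht]
  exact ENNReal.inv_le_inv.2 (ENNReal.ofReal_le_ofReal (hI hs ht hst))

lemma measurable_dens (hI : MonotoneOn I (Ioo 0 1)) : Measurable (dens I) := by
  refine measurable_of_Ioi fun a => ?_
  refine OrdConnected.measurableSet ⟨?_⟩
  intro x hx y hy z hz
  have hmem : ∀ {x}, x ∈ dens I ⁻¹' Ioi a → x ∈ Ioo (0 : ℝ) 1 := by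
    intro x hx
    by_contra h
    simp [dens_of_notMem h] at hx
  have hx' := hmem hx
  have hy' := hmem hy
  have hz' : z ∈ Ioo (0 : ℝ) 1 := ⟨hx'.1.trans_le hz.1, hz.2.trans_lt hy'.2⟩
  exact lt_of_lt_of_le hy (dens_antitoneOn hI hz' hy' hz.2)

lemma dens_ne_zero (t : ℝ) (ht : t ∈ Ioo (0 : ℝ) 1) : dens I t ≠ 0 := by
  simp [dens_of_mem ht]

lemma dens_ne_top (hpos : ∀ t ∈ Ioo (0 : ℝ) 1, 0 < I t) (t : ℝ) : dens I t ≠ ∞ := by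
  by_cases ht : t ∈ Ioo (0 : ℝ) 1
  · simp [dens_of_mem ht, hpos t ht]
  · simp [dens_of_notMem ht]

lemma measurable_densInt (hI : MonotoneOn I (Ioo 0 1)) :
    Measurable (Function.uncurry (densInt I)) := by
  have hS : MeasurableSet {q : (ℝ × ℝ) × ℝ | q.1.1 < q.2 ∧ q.2 < q.1.2} :=
    (measurableSet_lt (f := fun q : (ℝ × ℝ) × ℝ => q.1.1) (g := fun q => q.2)
      (by fun_prop) (by fun_prop)).inter
      (measurableSet_lt (f := fun q : (ℝ × ℝ) × ℝ => q.2) (g := fun q => q.1.2)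
        (by fun_prop) (by fun_prop))
  have hm : Measurable (({q : (ℝ × ℝ) × ℝ | q.1.1 < q.2 ∧ q.2 < q.1.2}).indicator
      fun q => dens I q.2) := ((measurable_dens hI).comp measurable_snd).indicator hS
  convert Measurable.lintegral_prod_right' (ν := volume) hm using 1
  funext q
  change ∫⁻ r in Ioo q.1 q.2, dens I r = _
  rw [← lintegral_indicator measurableSet_Ioo]
  rfl

lemma densInt_mono {s s' t t' : ℝ} (hs : s' ≤ s) (ht : t ≤ t') : densInt I s t ≤ densInt I s' t' :=
  lintegral_mono_set (Ioo_subset_Ioo hs ht)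

lemma densInt_le_add (s t u : ℝ) : densInt I s u ≤ densInt I s t + densInt I t u := by
  have h : Ioo s u ≤ᵐ[volume] (Ioo s t ∪ Ioo t u : Set ℝ) := by
    filter_upwards [Measure.ae_ne volume t] with x hx hxs
    rcases lt_or_gt_of_ne hx with h | h
    · exact Or.inl ⟨hxs.1, h⟩
    · exact Or.inr ⟨h, hxs.2⟩
  exact (lintegral_mono_set' h).trans (lintegral_union_le _ _ _)

lemma densInt_le_mul (hI : MonotoneOn I (Ioo 0 1)) {s t : ℝ} (hs : s ∈ Ioo (0 : ℝ) 1) :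
    densInt I s t ≤ dens I s * ENNReal.ofReal (t - s) := by
  calc densInt I s t ≤ ∫⁻ r in Ioo s t, dens I s := by
        refine setLIntegral_mono' measurableSet_Ioo fun r hr => ?_
        by_cases h : r ∈ Ioo (0 : ℝ) 1
        · exact dens_antitoneOn hI hs h hr.1.le
        · rw [dens_of_notMem h]; exact zero_le
    _ = _ := by simp

lemma mul_le_densInt (hI : MonotoneOn I (Ioo 0 1)) {s t : ℝ} (hs : 0 ≤ s) (ht : t < 1) :
    dens I t * ENNReal.ofReal (t - s) ≤ densInt I s t := by
  calc _ = ∫⁻ r in Ioo s t, dens I t := by simp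
    _ ≤ densInt I s t := by
        refine setLIntegral_mono' measurableSet_Ioo fun r hr => ?_
        exact dens_antitoneOn hI ⟨hs.trans_lt hr.1, hr.2.trans ht⟩
          ⟨hs.trans_lt (hr.1.trans hr.2), ht⟩ hr.2.le

lemma densInt_ne_top (hpos : ∀ t ∈ Ioo (0 : ℝ) 1, 0 < I t) (hI : MonotoneOn I (Ioo 0 1)) {s : ℝ}
    (hs : 0 < s) (t : ℝ) : densInt I s t ≠ ∞ := by
  rcases lt_or_ge s 1 with h1 | h1
  · exact ne_top_of_le_ne_top (ENNReal.mul_ne_top (dens_ne_top hpos s) ENNReal.ofReal_ne_top)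
      (densInt_le_mul hI ⟨hs, h1⟩)
  · have : densInt I s t = 0 := by
      rw [densInt, setLIntegral_congr_fun (g := fun _ => 0) measurableSet_Ioo]
      · simp
      · intro r hr
        exact dens_of_notMem fun h => absurd (h1.trans_lt hr.1) (not_lt.2 h.2.le)
    simp [this]

lemma densInt_zero_pos (hI : MonotoneOn I (Ioo 0 1)) {t : ℝ} (ht : t ∈ Ioo (0 : ℝ) 1) :
    densInt I 0 t ≠ 0 := by
  intro h
  have := mul_le_densInt hI le_rfl ht.2
  rw [h, nonpos_iff_eq_zero, mul_eq_zero] at this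
  rcases this with h | h
  · exact dens_ne_zero t ht h
  · simp at h
    linarith [ht.1]

/-- As `1/I` is non-increasing, its integral over `(t/2,t)` is at most `t/2` times its value at
`t/2`, which in turn is at most its integral over `(0,t/2)`. -/
lemma densInt_zero_le_two_mul (hI : MonotoneOn I (Ioo 0 1)) {t : ℝ} (ht0 : 0 < t) (ht1 : t ≤ 1) :
    densInt I 0 t ≤ 2 * densInt I 0 (t / 2) := by
  have h2 : t / 2 ∈ Ioo (0 : ℝ) 1 := ⟨by linarith, by linarith⟩
  calc densInt I 0 t ≤ densInt I 0 (t / 2) + densInt I (t / 2) t := densInt_le_add _ _ _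
    _ ≤ densInt I 0 (t / 2) + dens I (t / 2) * ENNReal.ofReal (t / 2 - 0) := by
        gcongr
        refine (densInt_le_mul hI h2).trans_eq ?_
        congr 2; ring
    _ ≤ densInt I 0 (t / 2) + densInt I 0 (t / 2) := by
        gcongr
        exact mul_le_densInt hI le_rfl h2.2
    _ = _ := (two_mul _).symm

lemma densInt_zero_le_of_forall {t : ℝ} {K : ℝ≥0∞} (ht : 0 < t)
    (h : ∀ e ∈ Ioo 0 t, densInt I e t ≤ K) : densInt I 0 t ≤ K := by
  have hpos : ∀ n : ℕ, 0 < t / ((n : ℝ) + 2) := fun n => by positivity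
  have hU : Ioo 0 t = ⋃ n : ℕ, Ioo (t / ((n : ℝ) + 2)) t := by
    ext x
    simp only [mem_iUnion, mem_Ioo]
    constructor
    · rintro ⟨h0, h1⟩
      obtain ⟨n, hn⟩ := exists_nat_gt (t / x)
      refine ⟨n, ?_, h1⟩
      rw [div_lt_iff₀ (by positivity)]
      rw [div_lt_iff₀ h0] at hn
      nlinarith
    · rintro ⟨n, h0, h1⟩
      exact ⟨(hpos n).trans h0, h1⟩
  have hmono : Monotone fun n : ℕ => Ioo (t / ((n : ℝ) + 2)) t := by
    intro i j hij
    refine Ioo_subset_Ioo_left ?_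
    have : (i : ℝ) ≤ j := by exact_mod_cast hij
    gcongr
  rw [densInt, hU, setLIntegral_iUnion_of_directed _ hmono.directed_le]
  refine iSup_le fun n => h _ ⟨hpos n, ?_⟩
  rw [div_lt_iff₀ (by positivity)]
  nlinarith [(n.cast_nonneg : (0:ℝ) ≤ n)]

/-- The measure with density `1 / I` of a sublevel set of its distribution function. -/
lemma setLIntegral_sublevel_le (y : ℝ≥0∞) :
    ∫⁻ r in {r | r ∈ Ioo (0 : ℝ) 1 ∧ densInt I 0 r ≤ y}, dens I r ≤ y := by
  set S : Set ℝ := {r | r ∈ Ioo (0 : ℝ) 1 ∧ densInt I 0 r ≤ y} with hS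
  rcases S.eq_empty_or_nonempty with h0 | h0
  · rw [h0]; simp
  have hbdd : BddAbove S := ⟨1, fun r hr => hr.1.2.le⟩
  obtain ⟨u, hu, hu2, hu3⟩ := exists_seq_tendsto_sSup h0 hbdd
  -- Up to its supremum the sublevel set is exhausted by intervals `(0, u n)` with `u n` in it, and
  -- each has measure at most `y`. This replaces the change of variables `y = Φ(r)`.
  have hsub : S ≤ᵐ[volume] ⋃ n, Ioo 0 (u n) := by
    filter_upwards [Measure.ae_ne volume (sSup S)] with x hx hxS
    have hlt : x < sSup S := lt_of_le_of_ne (le_csSup hbdd hxS) hx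
    obtain ⟨n, hn⟩ := (hu2.eventually (eventually_gt_nhds hlt)).exists
    exact mem_iUnion.2 ⟨n, hxS.1.1, hn⟩
  refine (lintegral_mono_set' hsub).trans ?_
  have hmono : Monotone fun n => Ioo 0 (u n) := fun i j hij => Ioo_subset_Ioo_right (hu hij)
  rw [setLIntegral_iUnion_of_directed _ hmono.directed_le]
  exact iSup_le fun n => (hu3 n).2

end dens

/-! ### Hedberg's estimate for the iterated Hardy operator -/

/-- The iterated Hardy kernel operator `u ↦ ∫_s^1 (u(t) / I(t)) (∫_s^t dr / I(r))^(k-1) dt`. -/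
noncomputable def kern (I : ℝ → ℝ) (k : ℕ) (u : ℝ → ℝ≥0∞) (s : ℝ) : ℝ≥0∞ :=
  ∫⁻ t in Ioo s 1, u t * dens I t * densInt I s t ^ (k - 1)

lemma kern_antitone (I : ℝ → ℝ) (k : ℕ) (u : ℝ → ℝ≥0∞) : Antitone (kern I k u) := by
  intro s s' h
  refine (lintegral_mono_set (Ioo_subset_Ioo_left h)).trans (lintegral_mono fun t => ?_)
  dsimp only
  gcongr
  exact densInt_mono h le_rfl

section pointwise
variable {I : ℝ → ℝ}

lemma measurable_densInt_right (hI : MonotoneOn I (Ioo 0 1)) (s : ℝ) : Measurable (densInt I s) :=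
  (measurable_densInt hI).comp (by fun_prop : Measurable fun t : ℝ => (s, t))

/-- A Hedberg type estimate for non-increasing functions of weak type. -/
lemma hedberg_antitone (hI : MonotoneOn I (Ioo 0 1)) {m k : ℕ} (hk : 1 ≤ k) (hkm : k < m)
    (hfin : ∀ s ∈ Ioo (0 : ℝ) 1, densInt I 0 s ≠ ∞) {U : ℝ → ℝ≥0∞} (hU : Antitone U)
    {C : ℝ≥0∞} (hC : C ≠ ∞) (hweak : ∀ s ∈ Ioo (0 : ℝ) 1, U s * densInt I 0 s ^ m ≤ C)
    {t : ℝ} (ht : t ∈ Ioo (0 : ℝ) 1) :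
    ∫⁻ s in Ioo t 1, U s * dens I s * densInt I 0 s ^ (k - 1) ≤
      (1 + 4 * C) * (U t ^ (1 / (m : ℝ))) ^ (m - k) := by
  have hm0 : (m : ℝ) ≠ 0 := by
    have : 0 < m := by omega
    positivity
  rcases eq_or_ne (U t) 0 with h0 | h0
  · have : ∫⁻ s in Ioo t 1, U s * dens I s * densInt I 0 s ^ (k - 1) = 0 := by
      rw [setLIntegral_congr_fun (g := fun _ => 0) measurableSet_Ioo]
      · simp
      · intro s hs
        have : U s = 0 := nonpos_iff_eq_zero.1 ((hU hs.1.le).trans_eq h0)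
        simp [this]
    rw [this]; exact zero_le
  have htop : U t ≠ ∞ := by
    intro h
    have := hweak t ht
    rw [h, ENNReal.top_mul (pow_ne_zero _ (densInt_zero_pos hI ht))] at this
    exact hC (top_le_iff.1 this)
  -- The cut is at `Φ = 1/a`, where the bounds `U ≤ U(t) = a^m` and `U ≤ CΦ^{-m}` balance up to `C`.
  -- The first serves on `A`, the second on the dyadic shells `B j`.
  set a : ℝ≥0∞ := U t ^ (1 / (m : ℝ)) with ha
  have ham : a ^ m = U t := by
    rw [ha, ← ENNReal.rpow_natCast, ← ENNReal.rpow_mul, one_div, inv_mul_cancel₀ hm0,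
      ENNReal.rpow_one]
  have ha0 : a ≠ 0 := by
    intro h; rw [h, zero_pow (by omega)] at ham; exact h0 ham.symm
  have hatop : a ≠ ∞ := by
    intro h; rw [h, ENNReal.top_pow (by omega)] at ham; exact htop ham.symm
  set z : ℕ → ℝ≥0∞ := fun j => 2 ^ j * a⁻¹ with hz
  have hz0 : ∀ j, z j ≠ 0 := fun j => mul_ne_zero (by simp) (ENNReal.inv_ne_zero.2 hatop)
  have hztop : ∀ j, z j ≠ ∞ := fun j =>
    ENNReal.mul_ne_top (ENNReal.pow_ne_top (by simp)) (ENNReal.inv_ne_top.2 ha0)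
  set A : Set ℝ := {s | s ∈ Ioo t 1 ∧ densInt I 0 s ≤ a⁻¹} with hA
  set B : ℕ → Set ℝ := fun j => {s | s ∈ Ioo (0 : ℝ) 1 ∧ z j < densInt I 0 s ∧
    densInt I 0 s ≤ 2 * z j} with hB
  have hmΦ := measurable_densInt_right hI 0
  have hAm : MeasurableSet A := measurableSet_Ioo.inter (measurableSet_le hmΦ measurable_const)
  have hBm : ∀ j, MeasurableSet (B j) := fun j => measurableSet_Ioo.inter
    ((measurableSet_lt measurable_const hmΦ).inter (measurableSet_le hmΦ measurable_const))
  have hcover : Ioo t 1 ⊆ A ∪ ⋃ j, B j := by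
    intro s hs
    have hs' : s ∈ Ioo (0 : ℝ) 1 := ⟨ht.1.trans hs.1, hs.2⟩
    by_cases h : densInt I 0 s ≤ a⁻¹
    · exact Or.inl ⟨hs, h⟩
    · push Not at h
      refine Or.inr (mem_iUnion.2 ?_)
      have hex : ∃ j, densInt I 0 s ≤ z j := by
        obtain ⟨n, hn⟩ := ENNReal.exists_nat_gt (ENNReal.mul_ne_top (hfin s hs') hatop)
        refine ⟨n, ?_⟩
        have h2n : (n : ℝ≥0∞) ≤ 2 ^ n := by exact_mod_cast Nat.lt_two_pow_self.le
        calc densInt I 0 s = densInt I 0 s * a * a⁻¹ := by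
              rw [mul_assoc, ENNReal.mul_inv_cancel ha0 hatop, mul_one]
          _ ≤ z n := by rw [hz]; dsimp only; gcongr; exact hn.le.trans h2n
      classical
      obtain ⟨j, hj⟩ : ∃ j, Nat.find hex = j + 1 := by
        refine Nat.exists_eq_succ_of_ne_zero fun h' => ?_
        have := Nat.find_spec hex
        rw [h'] at this
        simp only [hz, pow_zero, one_mul] at this
        exact absurd h (not_lt.2 this)
      refine ⟨j, hs', not_le.1 (Nat.find_min hex (by omega)), ?_⟩
      have := Nat.find_spec hex
      rw [hj] at this
      refine this.trans_eq ?_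
      simp only [hz]; ring
  have hIA : ∫⁻ s in A, U s * dens I s * densInt I 0 s ^ (k - 1) ≤ a ^ (m - k) := by
    calc _ ≤ ∫⁻ s in A, (a ^ m * a⁻¹ ^ (k - 1)) * dens I s := by
          refine setLIntegral_mono' hAm fun s hs => ?_
          rw [ham, mul_right_comm]
          have h1 := hU hs.1.1.le
          have h2 := hs.2
          gcongr
      _ = (a ^ m * a⁻¹ ^ (k - 1)) * ∫⁻ s in A, dens I s := by
          rw [lintegral_const_mul _ (measurable_dens hI)]
      _ ≤ (a ^ m * a⁻¹ ^ (k - 1)) * a⁻¹ := by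
          gcongr
          refine (lintegral_mono_set fun s hs => ?_).trans (setLIntegral_sublevel_le a⁻¹)
          exact ⟨⟨ht.1.trans hs.1.1, hs.1.2⟩, hs.2⟩
      _ = a ^ (m - k) := by
          rw [mul_assoc, ← pow_succ, Nat.sub_add_cancel hk]
          conv_lhs => rw [← Nat.sub_add_cancel hkm.le, pow_add]
          rw [mul_assoc, ← mul_pow, ENNReal.mul_inv_cancel ha0 hatop, one_pow, mul_one]
  -- On a shell the integrand against `1/I` is at most `C z_j^{-(m-k+1)}` and the mass is at most
  -- `2z_j`. Since `m - k ≥ 1`, the resulting bounds decay at least like `2^{-j}`; their sum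
  -- supplies the `4C`.
  have hIB : ∀ j, ∫⁻ s in B j, U s * dens I s * densInt I 0 s ^ (k - 1) ≤
      2 * C * a ^ (m - k) * 2⁻¹ ^ j := by
    intro j
    have hzp : z j ^ (m - k + 1) ≠ 0 := pow_ne_zero _ (hz0 j)
    have hzp' : z j ^ (m - k + 1) ≠ ∞ := ENNReal.pow_ne_top (hztop j)
    calc _ ≤ ∫⁻ s in B j, (C / z j ^ (m - k + 1)) * dens I s := by
          refine setLIntegral_mono' (hBm j) fun s hs => ?_
          rw [mul_right_comm]
          gcongr
          rw [ENNReal.le_div_iff_mul_le (Or.inl hzp) (Or.inl hzp')]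
          calc U s * densInt I 0 s ^ (k - 1) * z j ^ (m - k + 1)
              ≤ U s * densInt I 0 s ^ (k - 1) * densInt I 0 s ^ (m - k + 1) := by
                have := hs.2.1.le
                gcongr
            _ = U s * densInt I 0 s ^ m := by
                rw [mul_assoc, ← pow_add]; congr 2; omega
            _ ≤ C := hweak s hs.1
      _ = (C / z j ^ (m - k + 1)) * ∫⁻ s in B j, dens I s := by
          rw [lintegral_const_mul _ (measurable_dens hI)]
      _ ≤ (C / z j ^ (m - k + 1)) * (2 * z j) := by
          gcongr
          refine (lintegral_mono_set fun s hs => ?_).trans (setLIntegral_sublevel_le (2 * z j))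
          exact ⟨hs.1, hs.2.2⟩
      _ = 2 * C * (z j)⁻¹ ^ (m - k) := by
          rw [div_eq_mul_inv, pow_succ, ENNReal.mul_inv (Or.inr (hztop j)) (Or.inr (hz0 j)),
            ENNReal.inv_pow]
          calc C * ((z j)⁻¹ ^ (m - k) * (z j)⁻¹) * (2 * z j)
              = 2 * C * (z j)⁻¹ ^ (m - k) * ((z j)⁻¹ * z j) := by ring
            _ = _ := by rw [ENNReal.inv_mul_cancel (hz0 j) (hztop j), mul_one]
      _ ≤ 2 * C * (a ^ (m - k) * 2⁻¹ ^ j) := by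
          gcongr
          have : (z j)⁻¹ = 2⁻¹ ^ j * a := by
            rw [hz]; dsimp only
            rw [ENNReal.mul_inv (Or.inl (by simp)) (Or.inl (ENNReal.pow_ne_top (by simp))), inv_inv,
              ENNReal.inv_pow]
          rw [this, mul_pow, mul_comm]
          refine mul_le_mul_right ?_ _
          refine pow_le_of_le_one zero_le ?_ (by omega)
          exact pow_le_one₀ zero_le (by simp)
      _ = _ := by ring
  calc _ ≤ ∫⁻ s in A ∪ ⋃ j, B j, U s * dens I s * densInt I 0 s ^ (k - 1) := lintegral_mono_set hcover
    _ ≤ _ := lintegral_union_le _ _ _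
    _ ≤ a ^ (m - k) + ∑' j, 2 * C * a ^ (m - k) * 2⁻¹ ^ j :=
        add_le_add hIA ((lintegral_iUnion_le _ _).trans (ENNReal.tsum_le_tsum hIB))
    _ = _ := by
        rw [ENNReal.tsum_mul_left, ENNReal.tsum_geometric, ENNReal.one_sub_inv_two, inv_inv]
        ring

end pointwise

/-! ### Dyadic averages and their non-increasing majorant -/

/-- The average of `u` over `(x, c x)`, up to a constant. -/
noncomputable def blockAvg (c : ℝ) (u : ℝ → ℝ≥0∞) (x : ℝ) : ℝ≥0∞ :=
  (ENNReal.ofReal x)⁻¹ * ∫⁻ s in Ioo x (c * x), u s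

/-- The least non-increasing majorant of the dyadic averages of `u`. -/
noncomputable def supAvg (u : ℝ → ℝ≥0∞) (t : ℝ) : ℝ≥0∞ :=
  ⨆ (s : ℝ) (_ : t ≤ s ∧ s < 1), blockAvg 2 u s

lemma supAvg_antitone (u : ℝ → ℝ≥0∞) : Antitone (supAvg u) := fun _ _ h =>
  iSup_mono fun _ => iSup_mono' fun hs => ⟨⟨h.trans hs.1, hs.2⟩, le_rfl⟩

lemma blockAvg_le_supAvg (u : ℝ → ℝ≥0∞) {t : ℝ} (ht : t < 1) : blockAvg 2 u t ≤ supAvg u t :=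
  le_iSup₂_of_le (f := fun (s : ℝ) (_ : t ≤ s ∧ s < 1) => blockAvg 2 u s) t ⟨le_rfl, ht⟩ le_rfl

lemma lintegral_comp_mul_left {h : ℝ → ℝ≥0∞} (hh : Measurable h) {l : ℝ} (hl : 0 < l) :
    ∫⁻ x, h (l * x) = ENNReal.ofReal l⁻¹ * ∫⁻ x, h x := by
  rw [← lintegral_map hh (by fun_prop : Measurable fun x : ℝ => l * x),
    Real.map_volume_mul_left hl.ne', lintegral_smul_measure, abs_of_pos (inv_pos.2 hl), smul_eq_mul]

/-- The substitution `s = l x` exhibits the average as an integral of dilations of `u`, ready for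
Minkowski's inequality. -/
lemma blockAvg_eq {u : ℝ → ℝ≥0∞} (hu : Measurable u) (c : ℝ) {x : ℝ} (hx : 0 < x) :
    blockAvg c u x = ∫⁻ l in Ioo 1 c, u (l * x) := by
  have h := lintegral_comp_mul_left (hu.indicator (measurableSet_Ioo (a := x) (b := c * x))) hx
  rw [lintegral_indicator measurableSet_Ioo, ENNReal.ofReal_inv_of_pos hx] at h
  rw [blockAvg, ← h, ← lintegral_indicator measurableSet_Ioo]
  refine lintegral_congr fun l => ?_
  simp only [indicator_apply, mul_comm x l]
  have : l * x ∈ Ioo x (c * x) ↔ l ∈ Ioo 1 c := by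
    simp only [mem_Ioo, mul_lt_mul_iff_left₀ hx]
    rw [lt_mul_iff_one_lt_left hx]
  simp only [this]

lemma measurable_blockAvg {u : ℝ → ℝ≥0∞} (hu : Measurable u) (c : ℝ) : Measurable (blockAvg c u) := by
  have hS : MeasurableSet {q : ℝ × ℝ | q.1 < q.2 ∧ q.2 < c * q.1} :=
    (measurableSet_lt measurable_fst measurable_snd).inter
      (measurableSet_lt measurable_snd (measurable_fst.const_mul c))
  have hm : Measurable ({q : ℝ × ℝ | q.1 < q.2 ∧ q.2 < c * q.1}.indicator fun q => u q.2) :=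
    (hu.comp measurable_snd).indicator hS
  refine (ENNReal.measurable_ofReal.inv).mul ?_
  convert Measurable.lintegral_prod_right' (ν := volume) hm using 1
  funext q
  rw [← lintegral_indicator measurableSet_Ioo]
  rfl

/-- If the average over `(s, 2s)` exceeds `c` for some `s ≥ t`, so does the one over `(x, 4x)` for
every `x` in `(s/2, s)`: the interval contains `(s, 2s)` and `1/x ≥ 1/s`. Hence the larger averages
exceed `c` on a set of measure at least `t/2`. -/
lemma leb_supAvg_le (u : ℝ → ℝ≥0∞) (c : ℝ≥0) :
    leb {t | (c : ℝ≥0∞) < supAvg u t} ≤ 2 * leb {t | (c : ℝ≥0∞) < blockAvg 4 u t} := by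
  set L := leb {t | (c : ℝ≥0∞) < blockAvg 4 u t} with hL
  have hLfin : L ≠ ∞ := ne_top_of_le_ne_top ENNReal.one_ne_top (leb_le_one _)
  have h2 : 2 * L = ENNReal.ofReal (2 * L.toReal) := by
    rw [ENNReal.ofReal_mul (by norm_num), ENNReal.ofReal_toReal hLfin]; simp
  have hsub : {t | (c : ℝ≥0∞) < supAvg u t} ∩ Ioo 0 1 ⊆ Ioc 0 (2 * L.toReal) := by
    rintro t ⟨ht, ht0, ht1⟩
    simp only [mem_ofPred_eq, supAvg, lt_iSup_iff] at ht
    obtain ⟨s, ⟨hts, hs1⟩, hs⟩ := ht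
    have hs0 : 0 < s := ht0.trans_le hts
    refine ⟨ht0, hts.trans ?_⟩
    have hle : ENNReal.ofReal (s / 2) ≤ L := by
      have hvol : volume (Ioo (s / 2) s) = ENNReal.ofReal (s / 2) := by
        rw [Real.volume_Ioo]; congr 1; ring
      have hss : Ioo (s / 2) s ⊆ Ioo 0 1 := Ioo_subset_Ioo (by linarith) hs1.le
      rw [← hvol, ← inter_eq_left.2 hss, ← Measure.restrict_apply' measurableSet_Ioo]
      refine measure_mono fun x hx => ?_
      simp only [mem_ofPred_eq]
      refine hs.trans_le ?_
      have hx2 := hx.2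
      have hx1 := hx.1
      exact mul_le_mul' (ENNReal.inv_le_inv.2 (ENNReal.ofReal_le_ofReal hx2.le))
        (lintegral_mono_set (Ioo_subset_Ioo hx2.le (by linarith)))
    rw [ENNReal.ofReal_le_iff_le_toReal hLfin] at hle
    linarith
  rw [Measure.restrict_apply' measurableSet_Ioo, h2]
  refine (measure_mono hsub).trans_eq ?_
  simp

section norms
variable (X : RIFunctionNorm)

/-- The dilations with `l > 1` do not increase the norm of a function supported in `(0,1)`; the
constant is the length of `(1,4)`. -/
lemma norm_blockAvg_le {u : ℝ → ℝ≥0∞} (hu : Measurable u) (hsupp : ∀ x, x ∉ Ioo (0 : ℝ) 1 → u x = 0) :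
    X.norm (blockAvg 4 u) ≤ 3 * X.norm u := by
  rw [X.norm_congr (measurable_blockAvg hu 4).aemeasurable (g := fun x => ∫⁻ l in Ioo 1 4, u (l * x))
    (by filter_upwards [ae_restrict_mem measurableSet_Ioo] with x hx using blockAvg_eq hu 4 hx.1)]
  refine (X.norm_lintegral_le (F := fun l x => u (l * x)) (K := X.norm u)
    (hu.comp (by fun_prop : Measurable fun q : ℝ × ℝ => q.1 * q.2)) measurableSet_Ioo
    fun l hl => ?_).trans_eq ?_
  · refine X.norm_le_of_dist_le (hu.comp (by fun_prop)).aemeasurable hu.aemeasurable fun c => ?_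
    have hsub : {x | (c : ℝ≥0∞) < u x} ⊆ Ioo 0 1 := by
      intro x hx
      by_contra h
      simp [hsupp x h] at hx
    have hl1 : (1 : ℝ) < l := hl.1
    refine (leb_preimage_mul_le (zero_lt_one.trans hl1) _ hsub).trans ?_
    refine mul_le_of_le_one_left zero_le ?_
    rw [ENNReal.ofReal_le_one]
    exact inv_le_one_of_one_le₀ hl1.le
  · rw [Real.volume_Ioo, mul_comm]; congr 1; norm_num

lemma norm_supAvg_le {u : ℝ → ℝ≥0∞} (hu : Measurable u) (hsupp : ∀ x, x ∉ Ioo (0 : ℝ) 1 → u x = 0) :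
    X.norm (supAvg u) ≤ 6 * X.norm u := by
  refine (X.norm_le_two_mul_of_dist_le (supAvg_antitone u).measurable.aemeasurable
    (measurable_blockAvg hu 4).aemeasurable (leb_supAvg_le u)).trans ?_
  refine (mul_le_mul_right (norm_blockAvg_le X hu hsupp) 2).trans_eq ?_
  rw [← mul_assoc]; norm_num

lemma norm_comp_half_le {U : ℝ → ℝ≥0∞} (hU : Measurable U) :
    X.norm (fun x => U (x / 2)) ≤ 2 * X.norm U := by
  refine X.norm_le_two_mul_of_dist_le (hU.comp (by fun_prop)).aemeasurable hU.aemeasurable fun c => ?_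
  set A := {x | (c : ℝ≥0∞) < U x} ∩ Ioo 0 1 with hA
  calc leb {x | (c : ℝ≥0∞) < U (x / 2)} ≤ leb ((fun x => 2⁻¹ * x) ⁻¹' A) := by
        refine measure_mono_ae ?_
        filter_upwards [ae_restrict_mem measurableSet_Ioo] with x hx hxU
        change (c : ℝ≥0∞) < U (x / 2) at hxU
        refine ⟨?_, ?_, ?_⟩
        · change (c : ℝ≥0∞) < U (2⁻¹ * x)
          rwa [mul_comm, ← div_eq_mul_inv]
        · have := hx.1; dsimp only; linarith
        · have := hx.2; dsimp only; linarith
    _ ≤ ENNReal.ofReal 2⁻¹⁻¹ * leb A := leb_preimage_mul_le (by norm_num) A inter_subset_right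
    _ ≤ 2 * leb {x | (c : ℝ≥0∞) < U x} := by
        rw [inv_inv]
        gcongr
        · simp
        · exact inter_subset_left

end norms

section smoothing
variable {I : ℝ → ℝ}

/-- Substitute `s = l x` and average over `l` in `(1,2)`, which turns `u` into its dyadic averages.
The Jacobian costs at most 2, the power of `Φ` at most `2^{k-1}` by doubling, and `1/I` only grows;
the range `s > t` becomes `x > t/2`. -/
lemma kern_le_supAvg (hI : MonotoneOn I (Ioo 0 1)) {k : ℕ} (hk : 1 ≤ k) {u : ℝ → ℝ≥0∞}
    (hu : Measurable u) {t : ℝ} (ht : t ∈ Ioo (0 : ℝ) 1) :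
    kern I k u t ≤
      2 ^ k * ∫⁻ s in Ioo (t / 2) 1, supAvg u s * dens I s * densInt I 0 s ^ (k - 1) := by
  set w : ℝ → ℝ≥0∞ := fun s => dens I s * densInt I 0 s ^ (k - 1) with hw
  have hwm : Measurable w := (measurable_dens hI).mul ((measurable_densInt_right hI 0).pow_const _)
  set h : ℝ → ℝ≥0∞ := (Ioo t 1).indicator fun s => u s * w s with hh
  have hhm : Measurable h := (hu.mul hwm).indicator measurableSet_Ioo
  have hkern : kern I k u t ≤ ∫⁻ s, h s := by
    rw [hh, lintegral_indicator measurableSet_Ioo]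
    refine lintegral_mono fun s => ?_
    simp only [hw]
    rw [mul_assoc]
    gcongr
    exact densInt_mono ht.1.le le_rfl
  have hstep : ∀ l ∈ Ioo (1 : ℝ) 2, ∫⁻ s, h s ≤
      2 ^ k * ∫⁻ x in Ioo (t / 2) 1, u (l * x) * w x := by
    intro l hl
    have hl0 : 0 < l := zero_lt_one.trans hl.1
    have h1 : ∫⁻ s, h s = ENNReal.ofReal l * ∫⁻ x, h (l * x) := by
      rw [lintegral_comp_mul_left hhm hl0, ← mul_assoc, ← ENNReal.ofReal_mul hl0.le,
        mul_inv_cancel₀ hl0.ne', ENNReal.ofReal_one, one_mul]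
    have hl2 : ENNReal.ofReal l ≤ 2 := by
      rw [show (2 : ℝ≥0∞) = ENNReal.ofReal 2 by simp]
      exact ENNReal.ofReal_le_ofReal hl.2.le
    rw [h1, ← lintegral_indicator measurableSet_Ioo]
    calc ENNReal.ofReal l * ∫⁻ x, h (l * x)
        ≤ 2 * ∫⁻ x, 2 ^ (k - 1) * (Ioo (t / 2) 1).indicator (fun x => u (l * x) * w x) x := by
          gcongr with x
          by_cases hx : l * x ∈ Ioo t 1
          · have hx0 : 0 < x := by
              have := ht.1.trans hx.1
              exact pos_of_mul_pos_right this hl0.le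
            have hx1 : x ≤ l * x := by nlinarith [hl.1]
            have hx2 : x ∈ Ioo (t / 2) 1 := by
              refine ⟨?_, hx1.trans_lt hx.2⟩
              have := hx.1
              nlinarith [hl.2]
            have hlx : l * x ∈ Ioo (0 : ℝ) 1 := ⟨ht.1.trans hx.1, hx.2⟩
            have hΦ : densInt I 0 (l * x) ≤ 2 * densInt I 0 x := by
              refine (densInt_zero_le_two_mul hI hlx.1 hlx.2.le).trans ?_
              gcongr
              refine densInt_mono le_rfl ?_
              nlinarith [hl.2]
            have hd : dens I (l * x) ≤ dens I x := dens_antitoneOn hI ⟨hx0, hx2.2⟩ hlx hx1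
            rw [hh, indicator_of_mem hx, indicator_of_mem hx2]
            simp only [hw]
            calc u (l * x) * (dens I (l * x) * densInt I 0 (l * x) ^ (k - 1))
                ≤ u (l * x) * (dens I x * (2 * densInt I 0 x) ^ (k - 1)) := by gcongr
              _ = _ := by rw [mul_pow]; ring
          · rw [hh, indicator_of_notMem hx]; exact zero_le
      _ = _ := by
          rw [lintegral_const_mul, ← mul_assoc, ← pow_succ', Nat.sub_add_cancel hk]
          exact ((hu.comp (by fun_prop)).mul hwm).indicator measurableSet_Ioo
  calc kern I k u t ≤ ∫⁻ s, h s := hkern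
    _ = ∫⁻ l in Ioo (1 : ℝ) 2, ∫⁻ s, h s := by
        rw [setLIntegral_const, Real.volume_Ioo]; norm_num
    _ ≤ ∫⁻ l in Ioo (1 : ℝ) 2, 2 ^ k * ∫⁻ x in Ioo (t / 2) 1, u (l * x) * w x :=
        setLIntegral_mono' measurableSet_Ioo hstep
    _ = 2 ^ k * ∫⁻ l in Ioo (1 : ℝ) 2, ∫⁻ x in Ioo (t / 2) 1, u (l * x) * w x := by
        rw [lintegral_const_mul' _ _ (ENNReal.pow_ne_top (by simp))]
    _ = 2 ^ k * ∫⁻ x in Ioo (t / 2) 1, ∫⁻ l in Ioo (1 : ℝ) 2, u (l * x) * w x := by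
        rw [lintegral_lintegral_swap]
        exact ((hu.comp (by fun_prop : Measurable fun q : ℝ × ℝ => q.1 * q.2)).mul
          (hwm.comp measurable_snd)).aemeasurable
    _ ≤ _ := by
        refine mul_le_mul_right (setLIntegral_mono' measurableSet_Ioo fun x hx => ?_) _
        have hx0 : 0 < x := (by linarith [ht.1] : 0 < t / 2).trans hx.1
        rw [lintegral_mul_const (f := fun l => u (l * x)) _ (hu.comp (by fun_prop)), ← blockAvg_eq hu 2 hx0, mul_assoc]
        exact mul_le_mul_left (blockAvg_le_supAvg u hx.2) _

end smoothing

/-- Boundedness of the iterated Hardy operator from `X` into the power space of `X`. -/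
lemma exists_norm_kern_rpow_le (X : RIFunctionNorm) {I : ℝ → ℝ} (hI : MonotoneOn I (Ioo 0 1))
    {m k : ℕ} (hk : 1 ≤ k) (hkm : k < m) {C : ℝ≥0}
    (hC : ∀ t ∈ Ioo (0 : ℝ) 1, densInt I 0 t ^ m ≤ C * fundamental X t) :
    ∃ K : ℝ≥0∞, K ≠ ∞ ∧ ∀ u, Measurable u → (∀ x, x ∉ Ioo (0 : ℝ) 1 → u x = 0) → X.norm u ≤ 1 →
      X.norm (fun s => kern I k u s ^ ((m : ℝ) / ((m : ℝ) - (k : ℝ)))) ≤ K := by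
  set p : ℝ := (m : ℝ) / ((m : ℝ) - (k : ℝ)) with hp
  have hmk : (0 : ℝ) < (m : ℝ) - (k : ℝ) := by
    have : (k : ℝ) < m := by exact_mod_cast hkm
    linarith
  have hm0 : (0 : ℝ) < m := by
    have : (0 : ℝ) ≤ k := k.cast_nonneg
    linarith
  have hp0 : 0 < p := div_pos hm0 hmk
  have hfin : ∀ s ∈ Ioo (0 : ℝ) 1, densInt I 0 s ≠ ∞ := by
    intro s hs h
    have := hC s hs
    rw [h, ENNReal.top_pow (by omega), top_le_iff] at this
    exact ENNReal.mul_ne_top ENNReal.coe_ne_top (fundamental_ne_top X) this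
  -- The `2^k` comes from passing to averages, and `1 + 4(6C)` from Hedberg's estimate with
  -- weak-type constant `6C`, as the majorant has norm at most 6. The later 12 is 6 times the
  -- dilation constant 2.
  set M : ℝ≥0∞ := 2 ^ k * (1 + 4 * (C * 6)) with hM
  have hMfin : M ≠ ∞ := by
    refine ENNReal.mul_ne_top (ENNReal.pow_ne_top (by simp)) (ENNReal.add_ne_top.2 ⟨by simp, ?_⟩)
    exact ENNReal.mul_ne_top (by simp) (ENNReal.mul_ne_top (by simp) (by simp))
  refine ⟨M ^ p * 12, ENNReal.mul_ne_top (ENNReal.rpow_ne_top_of_nonneg hp0.le hMfin) (by simp), ?_⟩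
  intro u hu hsupp hu1
  have hV := norm_supAvg_le X hu hsupp
  have hV6 : X.norm (supAvg u) ≤ 6 := hV.trans (by simpa using mul_le_mul_right hu1 6)
  have hVm : Measurable (supAvg u) := (supAvg_antitone u).measurable
  have hweak : ∀ s ∈ Ioo (0 : ℝ) 1, supAvg u s * densInt I 0 s ^ m ≤ C * 6 := by
    intro s hs
    have h1 := mul_fundamental_le X (t := s) hVm.aemeasurable (a := supAvg u s)
      fun x hx => supAvg_antitone u hx.2.le
    calc supAvg u s * densInt I 0 s ^ m ≤ supAvg u s * (C * fundamental X s) :=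
          mul_le_mul_right (hC s hs) _
      _ = C * (supAvg u s * fundamental X s) := by ring
      _ ≤ C * 6 := mul_le_mul_right (h1.trans hV6) _
  have hpt : ∀ t ∈ Ioo (0 : ℝ) 1, kern I k u t ^ p ≤ M ^ p * supAvg u (t / 2) := by
    intro t ht
    have ht2 : t / 2 ∈ Ioo (0 : ℝ) 1 := ⟨by linarith [ht.1], by linarith [ht.1, ht.2]⟩
    have h1 : kern I k u t ≤ M * (supAvg u (t / 2) ^ (1 / (m : ℝ))) ^ (m - k) := by
      refine (kern_le_supAvg hI hk hu ht).trans ?_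
      rw [hM, mul_assoc]
      exact mul_le_mul_right (hedberg_antitone hI hk hkm hfin (supAvg_antitone u)
        (ENNReal.mul_ne_top (by simp) (by simp)) hweak ht2) _
    refine (ENNReal.rpow_le_rpow h1 hp0.le).trans_eq ?_
    rw [ENNReal.mul_rpow_of_nonneg _ _ hp0.le, ← ENNReal.rpow_natCast, ← ENNReal.rpow_mul,
      ← ENNReal.rpow_mul, Nat.cast_sub hkm.le]
    -- The exponent `p` is chosen to undo the power `(m-k)/m` produced by Hedberg's estimate.
    have : 1 / (m : ℝ) * (((m : ℝ) - k) * p) = 1 := by rw [hp]; field_simp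
    rw [this, ENNReal.rpow_one]
  have hm2 : Measurable fun t : ℝ => supAvg u (t / 2) := hVm.comp (by fun_prop)
  calc X.norm (fun s => kern I k u s ^ p) ≤ X.norm (fun t => M ^ p * supAvg u (t / 2)) := by
        refine X.norm_mono _ _ ((kern_antitone I k u).measurable.pow_const p).aemeasurable
          (hm2.const_mul _).aemeasurable ?_
        filter_upwards [ae_restrict_mem measurableSet_Ioo] with t ht using hpt t ht
    _ ≤ M ^ p * X.norm (fun t => supAvg u (t / 2)) := X.norm_smul_le hm2.aemeasurable _
    _ ≤ M ^ p * (2 * 6) := by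
        refine mul_le_mul_right ((norm_comp_half_le X hVm).trans (mul_le_mul_right hV6 _)) _
    _ = _ := by norm_num


/-! ### Duality and the optimal range space -/

/-- A measurable representative vanishing outside `(0,1)`. -/
lemma MPlus.exists_representative {f : ℝ → ℝ≥0∞} (hf : MPlus f) :
    ∃ f', Measurable f' ∧ (∀ x, x ∉ Ioo (0 : ℝ) 1 → f' x = 0) ∧ f =ᵐ[leb] f' := by
  obtain ⟨g, hg, hfg⟩ := hf
  refine ⟨(Ioo 0 1).indicator g, hg.indicator measurableSet_Ioo, fun x hx => by simp [hx], ?_⟩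
  filter_upwards [hfg, ae_restrict_mem measurableSet_Ioo] with x hx hx1
  simp [hx, hx1]

section duality
variable {I : ℝ → ℝ}

/-- The operator dual to `kern`, applied to `h`. -/
noncomputable def dualKern (I : ℝ → ℝ) (k : ℕ) (h : ℝ → ℝ≥0∞) (t : ℝ) : ℝ≥0∞ :=
  (ENNReal.ofReal (I t))⁻¹ * ∫⁻ s in Ioo 0 t, h s * invInt I s t ^ (k - 1)

/-- Tonelli on the triangle `s < t`. -/
lemma lintegral_mul_dualKern (hI : MonotoneOn I (Ioo 0 1)) (k : ℕ) {u h : ℝ → ℝ≥0∞}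
    (hu : Measurable u) (hh : Measurable h) :
    ∫⁻ t, u t * dualKern I k h t ∂leb = ∫⁻ s, h s * kern I k u s ∂leb := by
  set F : ℝ × ℝ → ℝ≥0∞ := fun q => u q.1 * dens I q.1 * (h q.2 * densInt I q.2 q.1 ^ (k - 1)) with hF
  have hd : Measurable fun q : ℝ × ℝ => densInt I q.2 q.1 := (measurable_densInt hI).comp measurable_swap
  have hFm : Measurable F := by
    refine ((hu.comp measurable_fst).mul ((measurable_dens hI).comp measurable_fst)).mul
      ((hh.comp measurable_snd).mul (hd.pow_const _))
  set T : Set (ℝ × ℝ) := {q | q.2 < q.1} with hT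
  have hTm : MeasurableSet T := measurableSet_lt measurable_snd measurable_fst
  have hsl : ∀ s : ℝ, Measurable fun r => densInt I r s := fun s =>
    (measurable_densInt hI).comp (by fun_prop : Measurable fun r : ℝ => (r, s))
  have hL : ∀ t ∈ Ioo (0 : ℝ) 1, u t * dualKern I k h t = ∫⁻ s, T.indicator F (t, s) ∂leb := by
    intro t ht
    have h1 : ∫⁻ s in Ioo 0 t, h s * invInt I s t ^ (k - 1) =
        ∫⁻ s in Ioo 0 t, h s * densInt I s t ^ (k - 1) :=
      setLIntegral_congr_fun measurableSet_Ioo fun s hs => by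
        rw [invInt_eq_densInt hs.1.le ht.2.le]
    rw [dualKern, h1, ← dens_of_mem ht, ← mul_assoc, 
      ← lintegral_const_mul (f := fun s => h s * densInt I s t ^ (k - 1)) _ (hh.mul ((hsl t).pow_const _)),
      ← lintegral_indicator measurableSet_Ioo, ← lintegral_indicator measurableSet_Ioo]
    refine lintegral_congr fun s => ?_
    by_cases hs0 : 0 < s <;> by_cases hst : s < t
    · have : s < 1 := hst.trans ht.2
      simp [indicator_apply, hs0, hst, this, hT, hF]
    · simp [indicator_apply, hst, hT]
    · simp [indicator_apply, hs0]
    · simp [indicator_apply, hs0]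
  have hR : ∀ s ∈ Ioo (0 : ℝ) 1, h s * kern I k u s = ∫⁻ t, T.indicator F (t, s) ∂leb := by
    intro s hs
    rw [kern, ← lintegral_const_mul (f := fun t => u t * dens I t * densInt I s t ^ (k - 1)) _ ((hu.mul (measurable_dens hI)).mul
      ((measurable_densInt_right hI s).pow_const _)),
      ← lintegral_indicator measurableSet_Ioo, ← lintegral_indicator measurableSet_Ioo]
    refine lintegral_congr fun t => ?_
    by_cases ht1 : t < 1 <;> by_cases hst : s < t
    · have : 0 < t := hs.1.trans hst
      simp only [indicator_apply, mem_Ioo, hst, ht1, this, and_self, if_true, hT, mem_ofPred_eq, hF]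
      ring
    · simp [indicator_apply, hst, hT]
    · simp [indicator_apply, ht1]
    · simp [indicator_apply, ht1]
  rw [setLIntegral_congr_fun measurableSet_Ioo hL, setLIntegral_congr_fun measurableSet_Ioo hR]
  exact lintegral_lintegral_swap (f := fun t s => T.indicator F (t, s)) (hFm.indicator hTm).aemeasurable

lemma hardy_antitone (I : ℝ → ℝ) (g : ℝ → ℝ≥0∞) : Antitone (hardy I g) := fun _ _ h =>
  lintegral_mono_set (Ioo_subset_Ioo_left h)

lemma hardy_iterate_antitone (I : ℝ → ℝ) (g : ℝ → ℝ≥0∞) {k : ℕ} (hk : 1 ≤ k) :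
    Antitone ((hardy I)^[k] g) := by
  obtain ⟨j, rfl⟩ := Nat.exists_eq_add_of_le' hk
  rw [Function.iterate_succ_apply']
  exact hardy_antitone I _

lemma hardy_eq (g : ℝ → ℝ≥0∞) {t : ℝ} (ht : 0 ≤ t) :
    hardy I g t = ∫⁻ r in Ioo t 1, g r * dens I r :=
  setLIntegral_congr_fun measurableSet_Ioo fun r hr => by
    rw [dens_of_mem ⟨ht.trans_lt hr.1, hr.2⟩, div_eq_mul_inv]

/-- Induction with Tonelli. The inner integral of `D(r,s)^k` against `dr/I(r)` is bounded crudely by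
`D(t,s)^{k+1}`; the factorials are not needed. -/
lemma hardy_iterate_le_kern (hI : MonotoneOn I (Ioo 0 1)) {f f' : ℝ → ℝ≥0∞} (hf' : Measurable f')
    (hff' : f =ᵐ[leb] f') (k : ℕ) : ∀ t : ℝ, 0 ≤ t → (hardy I)^[k + 1] f t ≤ kern I (k + 1) f' t := by
  induction k with
  | zero =>
    intro t ht
    rw [zero_add, Function.iterate_one, hardy_eq f ht, kern]
    refine le_of_eq (lintegral_congr_ae ?_)
    have : Ioo t 1 ⊆ Ioo (0 : ℝ) 1 := Ioo_subset_Ioo_left ht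
    filter_upwards [ae_restrict_of_ae_restrict_of_subset this hff'] with r hr
    simp [hr]
  | succ k ih =>
    intro t ht
    rw [Function.iterate_succ_apply', hardy_eq _ ht]
    set F : ℝ × ℝ → ℝ≥0∞ := fun q => (f' q.2 * dens I q.2 * densInt I q.1 q.2 ^ k) * dens I q.1 with hF
    have hFm : Measurable F :=
      (((hf'.comp measurable_snd).mul ((measurable_dens hI).comp measurable_snd)).mul
        ((measurable_densInt hI).pow_const _)).mul ((measurable_dens hI).comp measurable_fst)
    set T : Set (ℝ × ℝ) := {q | q.1 < q.2} with hT
    have hTm : MeasurableSet T := measurableSet_lt measurable_fst measurable_snd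
    calc ∫⁻ r in Ioo t 1, (hardy I)^[k + 1] f r * dens I r
        ≤ ∫⁻ r in Ioo t 1, kern I (k + 1) f' r * dens I r := by
          refine setLIntegral_mono' measurableSet_Ioo fun r hr => ?_
          exact mul_le_mul_left (ih r (ht.trans hr.1.le)) _
      _ = ∫⁻ r in Ioo t 1, (∫⁻ s in Ioo t 1, T.indicator F (r, s)) := by
          refine setLIntegral_congr_fun measurableSet_Ioo fun r hr => ?_
          rw [kern, ← lintegral_mul_const
            (f := fun s => f' s * dens I s * densInt I r s ^ (k + 1 - 1)) _ ((hf'.mul (measurable_dens hI)).mul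
            ((measurable_densInt_right hI r).pow_const _)), ← lintegral_indicator measurableSet_Ioo,
            ← lintegral_indicator measurableSet_Ioo]
          refine lintegral_congr fun s => ?_
          by_cases hs1 : s < 1 <;> by_cases hrs : r < s
          · have : t < s := hr.1.trans hrs
            simp [indicator_apply, hs1, hrs, this, hT, hF]
          · simp [indicator_apply, hrs, hT]
          · simp [indicator_apply, hs1]
          · simp [indicator_apply, hs1]
      _ = ∫⁻ s in Ioo t 1, (∫⁻ r in Ioo t 1, T.indicator F (r, s)) :=
          lintegral_lintegral_swap (f := fun r s => T.indicator F (r, s))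
            (hFm.indicator hTm).aemeasurable
      _ ≤ ∫⁻ s in Ioo t 1, f' s * dens I s * densInt I t s ^ (k + 1) := by
          refine setLIntegral_mono' measurableSet_Ioo fun s hs => ?_
          calc ∫⁻ r in Ioo t 1, T.indicator F (r, s)
              ≤ ∫⁻ r in Ioo t s, (f' s * dens I s * densInt I t s ^ k) * dens I r := by
                rw [← lintegral_indicator measurableSet_Ioo, ← lintegral_indicator measurableSet_Ioo]
                refine lintegral_mono fun r => ?_
                dsimp only
                by_cases hr : t < r
                · by_cases hrs : r < s
                  · have h1 : r ∈ Ioo t 1 := ⟨hr, hrs.trans hs.2⟩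
                    have h2 : r ∈ Ioo t s := ⟨hr, hrs⟩
                    have h3 : (r, s) ∈ T := hrs
                    rw [indicator_of_mem h1, indicator_of_mem h2, indicator_of_mem h3]
                    simp only [hF]
                    have := densInt_mono (I := I) hr.le (le_refl s)
                    gcongr
                  · simp [indicator_apply, hrs, hT]
                · simp [indicator_apply, hr]
            _ = f' s * dens I s * densInt I t s ^ k * densInt I t s := by
                rw [lintegral_const_mul _ (measurable_dens hI)]; rfl
            _ = _ := by rw [mul_assoc, ← pow_succ]
      _ = _ := by rw [kern, Nat.add_sub_cancel]

variable (X : RIFunctionNorm)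

/-- The kernel operator produces non-increasing functions, so Hardy–Littlewood replaces the test
function `h` by `h*`. Tonelli then moves the operator onto `h*`, where the norm of `X_k'` controls
it. -/
lemma optNorm_hardy_iterate_le (hI : MonotoneOn I (Ioo 0 1)) {k : ℕ} (hk : 1 ≤ k) {f : ℝ → ℝ≥0∞}
    (hf : MPlus f) : optNorm X I k ((hardy I)^[k] f) ≤ X.norm f := by
  obtain ⟨f', hf'm, -, hff'⟩ := hf.exists_representative
  refine iSup_le fun h => iSup_le fun hh => iSup_le fun hh1 => ?_
  have hm : Measurable (kern I k f') := (kern_antitone I k f').measurable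
  calc ∫⁻ s in Ioo 0 1, h s * (hardy I)^[k] f s ≤ ∫⁻ s, h s * kern I k f' s ∂leb := by
        refine setLIntegral_mono' measurableSet_Ioo fun s hs => mul_le_mul_right ?_ _
        have := hardy_iterate_le_kern hI hf'm hff' (k - 1) s hs.1.le
        rwa [Nat.sub_add_cancel hk] at this
    _ ≤ ∫⁻ s, rearr h s * kern I k f' s ∂leb :=
        lintegral_mul_le_rearr hh hm ((kern_antitone I k f').antitoneOn _)
    _ = ∫⁻ t, f' t * dualKern I k (rearr h) t ∂leb :=
        (lintegral_mul_dualKern hI k hf'm (measurable_rearr h)).symm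
    _ ≤ X.norm f' := X.lintegral_mul_le_norm hf'm.aemeasurable hh1
    _ = X.norm f := (X.norm_congr hf hff').symm

end duality

/-! ### Power spaces and the embedding of the optimal space -/

section power
variable (X : RIFunctionNorm)

/-- Hölder's inequality for the power spaces of `X`, up to a constant. -/
lemma norm_mul_le_powNorm {p q : ℝ} (hpq : p.HolderConjugate q) {f g : ℝ → ℝ≥0∞} (hf : MPlus f)
    (hg : MPlus g) : X.norm (fun x => f x * g x) ≤ 2 * (powNorm X p f * powNorm X q g) := by
  have hfg : MPlus fun x => f x * g x := hf.mul hg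
  have hp := hpq.pos
  have hq := hpq.symm.pos
  have hfp : MPlus fun x => f x ^ p := hf.pow_const p
  have hgq : MPlus fun x => g x ^ q := hg.pow_const q
  have hzero : ∀ {r : ℝ} {e : ℝ → ℝ≥0∞}, 0 < r → MPlus (fun x => e x ^ r) → powNorm X r e = 0 →
      e =ᵐ[leb] 0 := by
    intro r e hr he h
    rw [powNorm, ENNReal.rpow_eq_zero_iff_of_pos (by positivity), X.norm_eq_zero_iff _ he] at h
    filter_upwards [h] with x hx
    exact (ENNReal.rpow_eq_zero_iff_of_pos hr).1 hx
  rcases eq_or_ne (powNorm X p f) 0 with ha | ha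
  · have : X.norm (fun x => f x * g x) = 0 := by
      rw [X.norm_eq_zero_iff _ hfg]
      filter_upwards [hzero hp hfp ha] with x hx
      simp [hx]
    rw [this]; exact zero_le
  rcases eq_or_ne (powNorm X q g) 0 with hb | hb
  · have : X.norm (fun x => f x * g x) = 0 := by
      rw [X.norm_eq_zero_iff _ hfg]
      filter_upwards [hzero hq hgq hb] with x hx
      simp [hx]
    rw [this]; exact zero_le
  rcases eq_or_ne (powNorm X p f) ∞ with ha' | ha'
  · rw [ha', ENNReal.top_mul hb]; simp
  rcases eq_or_ne (powNorm X q g) ∞ with hb' | hb'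
  · rw [hb', ENNReal.mul_top ha]; simp
  have hunit : ∀ {r : ℝ} {e : ℝ → ℝ≥0∞}, 0 < r → MPlus (fun x => e x ^ r) → powNorm X r e ≠ 0 →
      powNorm X r e ≠ ∞ → X.norm (fun x => ((powNorm X r e)⁻¹ * e x) ^ r) ≤ 1 := by
    intro r e hr he h0 h1
    have hpow : powNorm X r e ^ r = X.norm fun x => e x ^ r := by
      rw [powNorm, ← ENNReal.rpow_mul, one_div, inv_mul_cancel₀ hr.ne', ENNReal.rpow_one]
    simp_rw [ENNReal.mul_rpow_of_nonneg _ _ hr.le]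
    refine (X.norm_smul_le he _).trans_eq ?_
    rw [← hpow, ← ENNReal.mul_rpow_of_nonneg _ _ hr.le, ENNReal.inv_mul_cancel h0 h1,
      ENNReal.one_rpow]
  set a := powNorm X p f
  set b := powNorm X q g
  have hf1 : MPlus fun x => (a⁻¹ * f x) ^ p := (hf.const_mul _).pow_const p
  have hg1 : MPlus fun x => (b⁻¹ * g x) ^ q := (hg.const_mul _).pow_const q
  have hdiv : ∀ {r : ℝ} (c : ℝ≥0∞), 1 ≤ r → c / ENNReal.ofReal r ≤ c := fun c hr =>
    ENNReal.div_le_of_le_mul (le_mul_of_one_le_right zero_le (by simpa using hr))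
  -- Young's inequality for the normalised functions, with the weights `1/p` and `1/q` dropped;
  -- hence the constant 2.
  calc X.norm (fun x => f x * g x)
      ≤ X.norm (fun x => (a * b) * ((a⁻¹ * f x) ^ p + (b⁻¹ * g x) ^ q)) := by
        refine X.norm_mono _ _ (hf.mul hg) ((hf1.add hg1).const_mul _) (Eventually.of_forall fun x => ?_)
        calc f x * g x = (a * a⁻¹) * (b * b⁻¹) * (f x * g x) := by
              rw [ENNReal.mul_inv_cancel ha ha', ENNReal.mul_inv_cancel hb hb']; simp
          _ = (a * b) * ((a⁻¹ * f x) * (b⁻¹ * g x)) := by ring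
          _ ≤ _ := by
              refine mul_le_mul_right ((ENNReal.young_inequality _ _ hpq).trans ?_) _
              exact add_le_add (hdiv _ hpq.lt.le) (hdiv _ hpq.symm.lt.le)
    _ ≤ (a * b) * X.norm (fun x => (a⁻¹ * f x) ^ p + (b⁻¹ * g x) ^ q) :=
        X.norm_smul_le (hf1.add hg1) _
    _ ≤ (a * b) * (1 + 1) := by
        refine mul_le_mul_right ((X.norm_add_le _ _ hf1 hg1).trans (add_le_add ?_ ?_)) _
        · exact hunit hp hfp ha ha'
        · exact hunit hq hgq hb hb'
    _ = _ := by ring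

lemma holderConjugate_div {m k : ℕ} (hk : 1 ≤ k) (hkm : k < m) :
    ((m : ℝ) / ((m : ℝ) - (k : ℝ))).HolderConjugate ((m : ℝ) / k) := by
  have h1 : (k : ℝ) < m := by exact_mod_cast hkm
  have h2 : (0 : ℝ) < k := by exact_mod_cast hk
  have h3 : (0 : ℝ) < (m : ℝ) - k := by linarith
  have h4 : (0 : ℝ) < m := by linarith
  rw [Real.holderConjugate_iff]
  constructor
  · rw [lt_div_iff₀ h3]; linarith
  · rw [inv_div, inv_div]; field_simp; ring

/-- The embedding of the optimal range space into the power space. -/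
lemma exists_powNorm_le_optNorm {I : ℝ → ℝ} (hI : MonotoneOn I (Ioo 0 1)) {m k : ℕ} (hk : 1 ≤ k)
    (hkm : k < m) {C : ℝ≥0} (hC : ∀ t ∈ Ioo (0 : ℝ) 1, densInt I 0 t ^ m ≤ C * fundamental X t) :
    ∃ K : ℝ≥0, 0 < K ∧ ∀ g, MPlus g →
      powNorm X ((m : ℝ) / ((m : ℝ) - (k : ℝ))) g ≤ K * optNorm X I k g := by
  obtain ⟨K, hKtop, hK⟩ := exists_norm_kern_rpow_le X hI hk hkm hC
  have hpq := holderConjugate_div hk hkm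
  have h2 : (0 : ℝ) < k := by exact_mod_cast hk
  have h4 : (0 : ℝ) < m := by
    have : (k : ℝ) < m := by exact_mod_cast hkm
    linarith
  set p : ℝ := (m : ℝ) / ((m : ℝ) - (k : ℝ)) with hp
  set q : ℝ := (m : ℝ) / k with hq
  have hp0 := hpq.pos
  have hq0 := hpq.symm.pos
  have hsum : 1 / q + 1 / p = 1 := by
    rw [one_div, one_div, add_comm]; exact hpq.inv_add_inv_eq_one
  -- Taking the maximum with 1 keeps `M` nonzero, so that it can be divided by.
  set M : ℝ≥0∞ := (max K 1) ^ (1 / p) with hM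
  have hM0 : M ≠ 0 := by
    refine (ENNReal.rpow_pos ?_ (max_ne_top hKtop ENNReal.one_ne_top)).ne'
    exact zero_lt_one.trans_le (le_max_right _ _)
  have hMtop : M ≠ ∞ :=
    ENNReal.rpow_ne_top_of_nonneg (by positivity) (max_ne_top hKtop ENNReal.one_ne_top)
  refine ⟨M.toNNReal, ENNReal.toNNReal_pos hM0 hMtop, fun g hg => ?_⟩
  rw [ENNReal.coe_toNNReal hMtop]
  obtain ⟨g', hg'm, -, hgg'⟩ := hg.exists_representative
  have hgp : X.norm (fun x => g x ^ p) = X.norm fun x => g' x ^ p :=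
    X.norm_congr (hg.pow_const p) (by filter_upwards [hgg'] with x hx; rw [hx])
  rw [powNorm, hgp]
  rw [one_div, ENNReal.rpow_inv_le_iff hp0]
  refine X.norm_le_of_forall_assoc (hg'm.pow_const p) fun η hη hη1 => ?_
  rw [lintegral_mul_eq_iSup_min (hg'm.pow_const p).aemeasurable hη.aemeasurable]
  refine iSup_le fun n => ?_
  -- Truncating `g^p` makes the pairing `A` finite, as needed to cancel `A^{1/q}` at the end.
  set b : ℝ → ℝ≥0∞ := fun x => min (g' x ^ p) (n : ℝ≥0∞) with hb
  have hbm : Measurable b := (hg'm.pow_const p).min measurable_const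
  set A : ℝ≥0∞ := ∫⁻ x, b x * η x ∂leb with hA
  rcases eq_or_ne A 0 with hA0 | hA0
  · change A ≤ _
    rw [hA0]; exact zero_le
  have hAtop : A ≠ ∞ := by
    have h1 : ∫⁻ x, n * η x ∂leb ≤ n * X.norm (fun _ => 1) := by
      rw [lintegral_const_mul _ hη]
      refine mul_le_mul_right ?_ _
      simpa using X.lintegral_mul_le_norm (f := fun _ => 1) aemeasurable_const hη1
    refine ne_top_of_le_ne_top (ENNReal.mul_ne_top (ENNReal.natCast_ne_top n) X.norm_one_lt_top.ne)
      (le_trans (lintegral_mono fun x => ?_) h1)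
    exact mul_le_mul_left (min_le_right _ _) _
  have hAq0 : A ^ (1 / q) ≠ 0 := (ENNReal.rpow_pos (pos_iff_ne_zero.2 hA0) hAtop).ne'
  have hAqtop : A ^ (1 / q) ≠ ∞ := ENNReal.rpow_ne_top_of_nonneg (by positivity) hAtop
  set c : ℝ≥0∞ := M * A ^ (1 / q) with hc
  have hc0 : c ≠ 0 := mul_ne_zero hM0 hAq0
  have hctop : c ≠ ∞ := ENNReal.mul_ne_top hMtop hAqtop
  -- The Hölder extremal: without truncation it is `g^{p-1} η`, normalised to pair to at most 1 with
  -- every `v` such that `‖v^p‖_X ≤ K`.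
  set f : ℝ → ℝ≥0∞ := fun x => c⁻¹ * (b x ^ (1 / q) * η x) with hf
  have hfm : Measurable f := ((hbm.pow_const _).mul hη).const_mul _
  have hholder : ∀ v : ℝ → ℝ≥0∞, Measurable v → X.norm (fun x => v x ^ p) ≤ K →
      ∫⁻ x, f x * v x ∂leb ≤ 1 := by
    intro v hv hvK
    have h1 : ∫⁻ x, b x ^ (1 / q) * η x * v x ∂leb ≤ c := by
      calc ∫⁻ x, b x ^ (1 / q) * η x * v x ∂leb
          = ∫⁻ x, ((fun x => b x ^ (1 / q)) * v) x ∂(leb.withDensity η) := by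
            rw [lintegral_withDensity_eq_lintegral_mul _ hη ((hbm.pow_const _).mul hv)]
            refine lintegral_congr fun x => ?_
            simp only [Pi.mul_apply]; ring
        _ ≤ (∫⁻ x, (b x ^ (1 / q)) ^ q ∂(leb.withDensity η)) ^ (1 / q) *
            (∫⁻ x, v x ^ p ∂(leb.withDensity η)) ^ (1 / p) :=
            ENNReal.lintegral_mul_le_Lp_mul_Lq _ hpq.symm (hbm.pow_const _).aemeasurable hv.aemeasurable
        _ ≤ A ^ (1 / q) * K ^ (1 / p) := by
            refine mul_le_mul' (le_of_eq ?_) (ENNReal.rpow_le_rpow ?_ (by positivity))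
            · congr 1
              rw [lintegral_withDensity_eq_lintegral_mul _ hη ((hbm.pow_const _).pow_const _), hA]
              refine lintegral_congr fun x => ?_
              simp only [Pi.mul_apply]
              rw [← ENNReal.rpow_mul, one_div, inv_mul_cancel₀ hq0.ne', ENNReal.rpow_one, mul_comm]
            · rw [lintegral_withDensity_eq_lintegral_mul _ hη (hv.pow_const _)]
              refine le_trans (le_of_eq (lintegral_congr fun x => ?_))
                ((X.lintegral_mul_le_norm (hv.pow_const p).aemeasurable hη1).trans hvK)
              simp only [Pi.mul_apply]; ring
        _ ≤ c := by
            rw [hc, mul_comm]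
            exact mul_le_mul_left (ENNReal.rpow_le_rpow (le_max_left _ _) (by positivity)) _
    calc ∫⁻ x, f x * v x ∂leb = c⁻¹ * ∫⁻ x, b x ^ (1 / q) * η x * v x ∂leb := by
          rw [← lintegral_const_mul' _ _ (ENNReal.inv_ne_top.2 hc0)]
          refine lintegral_congr fun x => ?_
          simp only [hf]; ring
      _ ≤ c⁻¹ * c := mul_le_mul_right h1 _
      _ = 1 := ENNReal.inv_mul_cancel hc0 hctop
  have hopt : optAssocNorm X I k f ≤ 1 := by
    refine iSup_le fun u => iSup_le fun hu => iSup_le fun hu1 => ?_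
    obtain ⟨u', hu'm, hu'0, huu'⟩ := hu.exists_representative
    -- The norm of `X_k'` sees `f*` rather than `f`. Composing with `σ` replaces `f*` by `f`, and
    -- the kernel term keeps its bound in `X^p`.
    obtain ⟨σ, hσ, hσf⟩ := exists_measurePreserving_rearr_le hfm
    have hkm' : Measurable (kern I k u') := (kern_antitone I k u').measurable
    calc ∫⁻ t, u t * dualKern I k (rearr f) t ∂leb
        = ∫⁻ t, u' t * dualKern I k (rearr f) t ∂leb :=
          lintegral_congr_ae (by filter_upwards [huu'] with x hx; rw [hx])
      _ = ∫⁻ s, rearr f s * kern I k u' s ∂leb :=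
          lintegral_mul_dualKern hI k hu'm (measurable_rearr f)
      _ = ∫⁻ x, rearr f (σ x) * kern I k u' (σ x) ∂leb :=
          (hσ.lintegral_comp ((measurable_rearr f).mul hkm')).symm
      _ ≤ ∫⁻ x, f x * kern I k u' (σ x) ∂leb :=
          lintegral_mono fun x => mul_le_mul_left (hσf x) _
      _ ≤ 1 := by
          refine hholder (fun x => kern I k u' (σ x)) (hkm'.comp hσ.measurable) ?_
          refine (X.norm_comp_measurePreserving (hkm'.pow_const p) hσ).trans (hK u' hu'm hu'0 ?_)
          rwa [← X.norm_congr hu huu']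
  have hlow : c⁻¹ * A ≤ optNorm X I k g := by
    refine le_iSup_of_le f (le_iSup_of_le hfm.aemeasurable (le_iSup_of_le hopt ?_))
    rw [hA, ← lintegral_const_mul' _ _ (ENNReal.inv_ne_top.2 hc0)]
    refine lintegral_mono_ae ?_
    filter_upwards [hgg'] with x hx
    have h1 : b x ^ (1 / p) ≤ g x := by
      rw [hx, one_div, ENNReal.rpow_inv_le_iff hp0]
      exact min_le_left _ _
    calc c⁻¹ * (b x * η x) = c⁻¹ * (b x ^ (1 / q) * b x ^ (1 / p) * η x) := by
          rw [← ENNReal.rpow_add_of_nonneg _ _ (by positivity) (by positivity), hsum, ENNReal.rpow_one]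
      _ = f x * b x ^ (1 / p) := by simp only [hf]; ring
      _ ≤ f x * g x := mul_le_mul_right h1 _
  -- Write `A` as `A^{1/q} A^{1/p}`; the first factor also sits in `c`, so cancelling it leaves the
  -- bound for `A^{1/p}`.
  have hAle : A ^ (1 / q) * A ^ (1 / p) ≤ A ^ (1 / q) * (M * optNorm X I k g) := by
    rw [← ENNReal.rpow_add_of_nonneg _ _ (by positivity) (by positivity), hsum, ENNReal.rpow_one]
    calc A = c * (c⁻¹ * A) := by rw [← mul_assoc, ENNReal.mul_inv_cancel hc0 hctop, one_mul]
      _ ≤ c * optNorm X I k g := mul_le_mul_right hlow _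
      _ = _ := by rw [hc]; ring
  have := (ENNReal.mul_le_mul_iff_right hAq0 hAqtop).1 hAle
  rwa [one_div, ENNReal.rpow_inv_le_iff hp0] at this

end power

/-! ### Necessity of the fundamental function condition -/

section lower
variable {I : ℝ → ℝ}

/-- The measure with density `1 / I` of a sublevel set of its tail function. -/
lemma setLIntegral_tail_sublevel_le (t a : ℝ) (y : ℝ≥0∞) :
    ∫⁻ r in {r | r ∈ Ioo t a ∧ densInt I r a ≤ y}, dens I r ≤ y := by
  set S : Set ℝ := {r | r ∈ Ioo t a ∧ densInt I r a ≤ y} with hS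
  rcases S.eq_empty_or_nonempty with h0 | h0
  · rw [h0]; simp
  have hbdd : BddBelow S := ⟨t, fun r hr => hr.1.1.le⟩
  obtain ⟨u, hu, hu2, hu3⟩ := exists_seq_tendsto_sInf h0 hbdd
  have hsub : S ≤ᵐ[volume] ⋃ n, Ioo (u n) a := by
    filter_upwards [Measure.ae_ne volume (sInf S)] with x hx hxS
    have hlt : sInf S < x := lt_of_le_of_ne (csInf_le hbdd hxS) hx.symm
    obtain ⟨n, hn⟩ := (hu2.eventually (eventually_lt_nhds hlt)).exists
    exact mem_iUnion.2 ⟨n, hn, hxS.1.2⟩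
  refine (lintegral_mono_set' hsub).trans ?_
  have hmono : Monotone fun n => Ioo (u n) a := fun i j hij => Ioo_subset_Ioo_left (hu hij)
  rw [setLIntegral_iUnion_of_directed _ hmono.directed_le]
  exact iSup_le fun n => (hu3 n).2

/-- In the inductive step keep only those `r` in `(t,a)` with `D(r,a) ≥ D(t,a)/2`. They carry at
least half of the mass of `dr/I(r)`, because the discarded set is a sublevel set of the tail
function. -/
lemma exists_le_hardy_iterate_indicator (hpos : ∀ t ∈ Ioo (0 : ℝ) 1, 0 < I t)
    (hI : MonotoneOn I (Ioo 0 1)) (k : ℕ) : ∃ c : ℝ≥0, 0 < c ∧ ∀ a ∈ Ioo (0 : ℝ) 1, ∀ t ∈ Ioo 0 a,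
      c * densInt I t a ^ k ≤ (hardy I)^[k] ((Ioo 0 a).indicator fun _ => 1) t := by
  induction k with
  | zero =>
    refine ⟨1, one_pos, fun a _ t ht => ?_⟩
    simp [indicator_of_mem ht]
  | succ k ih =>
    obtain ⟨c, hc, hle⟩ := ih
    refine ⟨c * 2⁻¹ ^ (k + 1), by positivity, fun a ha t ht => ?_⟩
    rw [Function.iterate_succ_apply', hardy_eq _ ht.1.le]
    set y := densInt I t a with hy
    have hytop : y ≠ ∞ := densInt_ne_top hpos hI ht.1 a
    set S : Set ℝ := {r | r ∈ Ioo t a ∧ densInt I r a ≤ y / 2} with hS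
    have hm : Measurable fun r => densInt I r a :=
      (measurable_densInt hI).comp (by fun_prop : Measurable fun r : ℝ => (r, a))
    have hSm : MeasurableSet S := measurableSet_Ioo.inter (measurableSet_le hm measurable_const)
    have hhalf : y / 2 ≤ ∫⁻ r in Ioo t a \ S, dens I r := by
      have h1 : y ≤ y / 2 + ∫⁻ r in Ioo t a \ S, dens I r := by
        calc y = ∫⁻ r in Ioo t a, dens I r := rfl
          _ = (∫⁻ r in Ioo t a ∩ S, dens I r) + ∫⁻ r in Ioo t a \ S, dens I r :=
            (lintegral_inter_add_sdiff _ _ hSm).symm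
          _ ≤ _ := by
            refine add_le_add ((lintegral_mono_set inter_subset_right).trans ?_) le_rfl
            exact setLIntegral_tail_sublevel_le t a (y / 2)
      conv_lhs at h1 => rw [← ENNReal.add_halves y]
      exact (ENNReal.add_le_add_iff_left (ENNReal.div_ne_top hytop two_ne_zero)).1 h1
    calc ((c * 2⁻¹ ^ (k + 1) : ℝ≥0) : ℝ≥0∞) * y ^ (k + 1)
        = (c * (y / 2) ^ k) * (y / 2) := by
          push_cast
          rw [mul_assoc, mul_assoc, ← pow_succ, ← mul_pow, div_eq_mul_inv, mul_comm y]
      _ ≤ (c * (y / 2) ^ k) * ∫⁻ r in Ioo t a \ S, dens I r := mul_le_mul_right hhalf _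
      _ = ∫⁻ r in Ioo t a \ S, (c * (y / 2) ^ k) * dens I r :=
          (lintegral_const_mul _ (measurable_dens hI)).symm
      _ ≤ ∫⁻ r in Ioo t a \ S, (hardy I)^[k] ((Ioo 0 a).indicator fun _ => 1) r * dens I r := by
          refine setLIntegral_mono' (measurableSet_Ioo.diff hSm) fun r hr => mul_le_mul_left ?_ _
          have hr2 : y / 2 ≤ densInt I r a := by
            by_contra hcon
            exact hr.2 ⟨hr.1, (not_le.1 hcon).le⟩
          refine le_trans ?_ (hle a ha r ⟨ht.1.trans hr.1.1, hr.1.2⟩)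
          gcongr
      _ ≤ _ := lintegral_mono_set (sdiff_subset.trans (Ioo_subset_Ioo_right ha.2.le))

end lower

/-- A self-improvement argument along points where `φ` is roughly halved. -/
lemma exists_pow_le_of_halving {φ : ℝ → ℝ} {D : ℝ → ℝ → ℝ} {m : ℕ} (hm : m ≠ 0)
    (hφpos : ∀ t ∈ Ioo (0 : ℝ) 1, 0 < φ t) (hφmono : Monotone φ)
    (hφ2 : ∀ t ∈ Ioo (0 : ℝ) 1, φ t ≤ 2 * φ (t / 2)) (hD0 : ∀ e a, 0 ≤ D e a)
    (hDadd : ∀ e t a, 0 < e → e < t → t < a → a < 1 → D e a ≤ D e t + D t a) {C : ℝ} (hC : 0 ≤ C)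
    (hD : ∀ e a, 0 < e → e < a → a < 1 → D e a ^ m * φ e ≤ C * φ a ^ 2) :
    ∃ K : ℝ, 0 ≤ K ∧ ∀ e a, 0 < e → e < a → a < 1 → D e a ^ m ≤ K * φ a := by
  have hm' : (m : ℝ) ≠ 0 := by exact_mod_cast hm
  set ρ : ℝ → ℝ := fun t => φ t ^ (1 / (m : ℝ)) with hρ
  set C₁ : ℝ := (4 * C) ^ (1 / (m : ℝ)) with hC₁
  set θ : ℝ := (1 / 2 : ℝ) ^ (1 / (m : ℝ)) with hθ
  have hθ1 : θ < 1 := Real.rpow_lt_one (by norm_num) (by norm_num) (by positivity)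
  have hC₁0 : 0 ≤ C₁ := by positivity
  -- The fixed point of `K ↦ Kθ + C₁`, so that the constant does not grow along the induction; `θ`
  -- is the factor by which `φ^{1/m}` drops when `φ` is halved.
  set K : ℝ := C₁ / (1 - θ) with hK
  have hθ1' : 0 < 1 - θ := by linarith
  have hK0 : 0 ≤ K := by positivity
  have hKC : K * θ + C₁ = K := by rw [hK]; field_simp; ring
  have hC₁K : C₁ ≤ K := by
    have : 0 ≤ K * θ := mul_nonneg hK0 (by positivity)
    linarith
  have hmem : ∀ {e a : ℝ}, 0 < e → e < a → a < 1 → e ∈ Ioo (0 : ℝ) 1 ∧ a ∈ Ioo (0 : ℝ) 1 :=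
    fun h1 h2 h3 => ⟨⟨h1, h2.trans h3⟩, ⟨h1.trans h2, h3⟩⟩
  have hdirect : ∀ e a, 0 < e → e < a → a < 1 → φ a ≤ 4 * φ e → D e a ≤ C₁ * ρ a := by
    intro e a he hea ha h4
    obtain ⟨hem, ham⟩ := hmem he hea ha
    have hφe := hφpos e hem
    have hφa := hφpos a ham
    have h1 : D e a ^ m ≤ 4 * C * φ a := by
      have h2 := hD e a he hea ha
      have h3 : D e a ^ m * φ e ≤ (4 * C * φ a) * φ e := by
        refine h2.trans ?_
        nlinarith [mul_nonneg hC hφa.le]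
      exact le_of_mul_le_mul_right h3 hφe
    calc D e a = (D e a ^ m) ^ (1 / (m : ℝ)) := by
          rw [one_div, Real.pow_rpow_inv_natCast (hD0 e a) hm]
      _ ≤ (4 * C * φ a) ^ (1 / (m : ℝ)) :=
          Real.rpow_le_rpow (pow_nonneg (hD0 e a) _) h1 (by positivity)
      _ = C₁ * ρ a := Real.mul_rpow (by positivity) hφa.le
  have key : ∀ n : ℕ, ∀ e a, 0 < e → e < a → a < 1 → φ a ≤ 2 ^ n * φ e → D e a ≤ K * ρ a := by
    intro n
    induction n with
    | zero =>
      intro e a he hea ha h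
      obtain ⟨hem, ham⟩ := hmem he hea ha
      refine (hdirect e a he hea ha ?_).trans ?_
      · have := hφpos e hem
        simp only [pow_zero, one_mul] at h
        linarith
      · exact mul_le_mul_of_nonneg_right hC₁K (Real.rpow_nonneg (hφpos a ham).le _)
    | succ n ih =>
      intro e a he hea ha h
      obtain ⟨hem, ham⟩ := hmem he hea ha
      have hφa := hφpos a ham
      have hρa : 0 ≤ ρ a := Real.rpow_nonneg hφa.le _
      by_cases h4 : φ a ≤ 4 * φ e
      · exact (hdirect e a he hea ha h4).trans (mul_le_mul_of_nonneg_right hC₁K hρa)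
      push Not at h4
      -- Take the first dyadic fraction of `a` at which `φ` is at most `φ(a)/2`. Doubling keeps `φ`
      -- at least `φ(a)/4` there, which exceeds `φ(e)`, so the point lies right of `e`.
      obtain ⟨t, het, hta, h5, h6⟩ : ∃ t, e < t ∧ t < a ∧ φ t ≤ φ a / 2 ∧ φ a ≤ 4 * φ t := by
        have hex : ∃ j : ℕ, φ (a / 2 ^ j) ≤ φ a / 2 := by
          obtain ⟨j, hj⟩ := pow_unbounded_of_one_lt (a / e) (one_lt_two)
          refine ⟨j, ?_⟩
          have : a / 2 ^ j ≤ e := by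
            rw [div_lt_iff₀ he] at hj
            rw [div_le_iff₀ (by positivity)]; linarith
          linarith [hφmono this, hφpos e hem]
        classical
        obtain ⟨j, hj⟩ : ∃ j, Nat.find hex = j + 1 := by
          refine Nat.exists_eq_succ_of_ne_zero fun h' => ?_
          have := Nat.find_spec hex
          rw [h'] at this
          simp only [pow_zero, div_one] at this
          linarith
        have hspec := Nat.find_spec hex
        have hmin := Nat.find_min hex (m := j) (by omega)
        rw [hj] at hspec
        push Not at hmin
        have haj : a / 2 ^ j ∈ Ioo (0 : ℝ) 1 := by
          refine ⟨by have := ham.1; positivity, lt_of_le_of_lt ?_ ham.2⟩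
          exact div_le_self ham.1.le (one_le_pow₀ one_le_two)
        have hhalf := hφ2 _ haj
        have heq : a / 2 ^ j / 2 = a / 2 ^ (j + 1) := by rw [pow_succ, div_div]
        rw [heq] at hhalf
        refine ⟨a / 2 ^ (j + 1), ?_, ?_, hspec, by linarith⟩
        · by_contra hcon
          have := hφmono (not_lt.1 hcon)
          linarith
        · exact div_lt_self ham.1 (one_lt_pow₀ one_lt_two (by omega))
      have htm : t ∈ Ioo (0 : ℝ) 1 := ⟨he.trans het, hta.trans ha⟩
      have h7 : D e t ≤ K * ρ t := by
        refine ih e t he het htm.2 ?_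
        rw [pow_succ] at h
        linarith
      have h8 : ρ t ≤ θ * ρ a := by
        rw [hρ, hθ, ← Real.mul_rpow (by norm_num) hφa.le]
        exact Real.rpow_le_rpow (hφpos t htm).le (by linarith) (by positivity)
      calc D e a ≤ D e t + D t a := hDadd e t a he het hta ha
        _ ≤ K * (θ * ρ a) + C₁ * ρ a :=
            add_le_add (h7.trans (mul_le_mul_of_nonneg_left h8 hK0))
              (hdirect t a htm.1 hta ha h6)
        _ = (K * θ + C₁) * ρ a := by ring
        _ = K * ρ a := by rw [hKC]
  refine ⟨K ^ m, by positivity, fun e a he hea ha => ?_⟩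
  obtain ⟨hem, ham⟩ := hmem he hea ha
  obtain ⟨n, hn⟩ := pow_unbounded_of_one_lt (φ a / φ e) (one_lt_two)
  rw [div_lt_iff₀ (hφpos e hem)] at hn
  calc D e a ^ m ≤ (K * ρ a) ^ m := pow_le_pow_left₀ (hD0 e a) (key n e a he hea ha hn.le) m
    _ = K ^ m * φ a := by
        rw [mul_pow, hρ]; dsimp only
        rw [one_div, Real.rpow_inv_natCast_pow (hφpos a ham).le hm]

/-- Both functions are taken to be `χ_(0,a)`. On `(0,e)` the product of their Hardy iterates is at
least a multiple of `D(e,a)^m`, which yields the hypothesis of the halving argument. -/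
lemma exists_densInt_pow_le_fundamental (X : RIFunctionNorm) {I : ℝ → ℝ}
    (hpos : ∀ t ∈ Ioo (0 : ℝ) 1, 0 < I t) (hI : MonotoneOn I (Ioo 0 1)) {m k : ℕ} (hk : 1 ≤ k)
    (hkm : k < m) {C : ℝ≥0}
    (hC : ∀ f g, MPlus f → MPlus g →
      X.norm (fun x => (hardy I)^[k] f x * (hardy I)^[m - k] g x) ≤ C * X.norm f * X.norm g) :
    ∃ K : ℝ≥0, 0 < K ∧ ∀ t ∈ Ioo (0 : ℝ) 1, densInt I 0 t ^ m ≤ K * fundamental X t := by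
  obtain ⟨c₁, hc₁, h₁⟩ := exists_le_hardy_iterate_indicator hpos hI k
  obtain ⟨c₂, hc₂, h₂⟩ := exists_le_hardy_iterate_indicator hpos hI (m - k)
  have hprod : ∀ e a, 0 < e → e < a → a < 1 →
      ((c₁ * c₂ : ℝ≥0) : ℝ≥0∞) * densInt I e a ^ m * fundamental X e ≤
        C * fundamental X a * fundamental X a := by
    intro e a he hea ha
    set χ : ℝ → ℝ≥0∞ := (Ioo 0 a).indicator fun _ => 1 with hχ
    have hχm : MPlus χ := (measurable_indicator_one a).aemeasurable
    refine le_trans (mul_fundamental_le X (t := e)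
      (U := fun x => (hardy I)^[k] χ x * (hardy I)^[m - k] χ x) ?_ ?_) (hC χ χ hχm hχm)
    · exact ((hardy_iterate_antitone I χ hk).measurable.mul
        (hardy_iterate_antitone I χ (by omega)).measurable).aemeasurable
    · intro x hx
      have hxa : x ∈ Ioo 0 a := ⟨hx.1, hx.2.trans hea⟩
      have ham : a ∈ Ioo (0 : ℝ) 1 := ⟨he.trans hea, ha⟩
      have hd : densInt I e a ≤ densInt I x a := densInt_mono hx.2.le le_rfl
      calc ((c₁ * c₂ : ℝ≥0) : ℝ≥0∞) * densInt I e a ^ m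
          = (c₁ * densInt I e a ^ k) * (c₂ * densInt I e a ^ (m - k)) := by
            conv_lhs => rw [← Nat.add_sub_cancel' hkm.le, pow_add]
            push_cast; ring
        _ ≤ (c₁ * densInt I x a ^ k) * (c₂ * densInt I x a ^ (m - k)) := by gcongr
        _ ≤ _ := mul_le_mul' (h₁ a ham x hxa) (h₂ a ham x hxa)
  have hm0 : m ≠ 0 := by omega
  obtain ⟨K, hK0, hK⟩ := exists_pow_le_of_halving (φ := fun t => (fundamental X t).toReal)
    (D := fun e a => if 0 < e then (densInt I e a).toReal else 0) (m := m) hm0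
    (fun t ht => ENNReal.toReal_pos (fundamental_pos X ht.1) (fundamental_ne_top X))
    (fun s t hst => ENNReal.toReal_mono (fundamental_ne_top X) (fundamental_mono X hst))
    (fun t ht => by
      have := ENNReal.toReal_mono (ENNReal.mul_ne_top (by simp) (fundamental_ne_top X))
        (fundamental_le_two_mul X ht.2.le)
      simpa using this)
    (fun e a => by split_ifs <;> simp)
    (fun e t a he het hta ha => by
      have ht := he.trans het
      simp only [he, ht, if_true]
      rw [← ENNReal.toReal_add (densInt_ne_top hpos hI he t) (densInt_ne_top hpos hI ht a)]
      exact ENNReal.toReal_mono (ENNReal.add_ne_top.2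
        ⟨densInt_ne_top hpos hI he t, densInt_ne_top hpos hI ht a⟩) (densInt_le_add _ _ _))
    (C := C / (c₁ * c₂)) (by positivity)
    (fun e a he hea ha => by
      have h := ENNReal.toReal_mono (ENNReal.mul_ne_top (ENNReal.mul_ne_top ENNReal.coe_ne_top
        (fundamental_ne_top X)) (fundamental_ne_top X)) (hprod e a he hea ha)
      simp only [ENNReal.toReal_mul, ENNReal.toReal_pow, ENNReal.coe_toReal, NNReal.coe_mul] at h
      simp only [he, if_true]
      rw [div_mul_eq_mul_div, le_div_iff₀ (by positivity)]
      nlinarith [h])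
  refine ⟨K.toNNReal + 1, by positivity, fun t ht => ?_⟩
  have hK' : ∀ e, e ∈ Ioo 0 t → densInt I e t ^ m ≤ (K.toNNReal + 1 : ℝ≥0) * fundamental X t := by
    intro e he
    have h := hK e t he.1 he.2 ht.2
    simp only [he.1, if_true] at h
    rw [← ENNReal.ofReal_toReal (ENNReal.pow_ne_top (densInt_ne_top hpos hI he.1 t) : densInt I e t ^ m ≠ ∞),
      ENNReal.toReal_pow]
    refine (ENNReal.ofReal_le_ofReal h).trans ?_
    rw [ENNReal.ofReal_mul hK0, ENNReal.ofReal_toReal (fundamental_ne_top X)]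
    refine mul_le_mul_left ?_ _
    rw [ENNReal.ofReal, ENNReal.coe_le_coe]
    exact le_self_add
  set R : ℝ≥0∞ := (K.toNNReal + 1 : ℝ≥0) * fundamental X t with hR
  -- Passing to `m`-th roots makes the bound one for the integral itself, so that `e → 0` is
  -- monotone convergence.
  have hroot : densInt I 0 t ≤ R ^ (1 / (m : ℝ)) := by
    refine densInt_zero_le_of_forall ht.1 fun e he => ?_
    rw [one_div, ENNReal.le_rpow_inv_iff (by positivity), ENNReal.rpow_natCast]
    exact hK' e he
  rwa [one_div, ENNReal.le_rpow_inv_iff (by positivity), ENNReal.rpow_natCast] at hroot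

lemma rearr_indicator_one {s t : ℝ} (hst : s < t) (hs : 0 ≤ s) (ht : t ≤ 1) :
    1 ≤ rearr ((Ioo 0 t).indicator fun _ => 1) s := by
  refine le_of_forall_lt_imp_le_of_dense fun a ha => ?_
  have hafin : a ≠ ∞ := ha.ne_top
  lift a to ℝ≥0 using hafin
  have ha' : a < 1 := by exact_mod_cast ha
  refine ((lt_rearr_iff _ _ _).2 ?_).le
  rw [setOf_lt_indicator_one, if_pos ha', leb_Ioo ht]
  exact (ENNReal.ofReal_lt_ofReal_iff (hs.trans_lt hst)).2 hst

end RISpace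

/-! ### The equivalences -/

theorem lemma3p2 (m : ℕ) (hm : 2 ≤ m) (I : ℝ → ℝ)
    (hIpos : ∀ t ∈ Ioo (0 : ℝ) 1, 0 < I t) (hImono : MonotoneOn I (Ioo (0 : ℝ) 1))
    (X : RISpace.RIFunctionNorm) :
    List.TFAE [
      RISpace.ConvergesAtZero I ∧ ∃ C : ℝ≥0, 0 < C ∧ ∀ g, RISpace.MPlus g →
        (⨆ t ∈ Ioo (0 : ℝ) 1, RISpace.maxRearr g t * RISpace.psi I m t) ≤ C * X.norm g,
      RISpace.ConvergesAtZero I ∧ ∃ C : ℝ≥0, 0 < C ∧ ∀ g, RISpace.MPlus g →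
        (⨆ t ∈ Ioo (0 : ℝ) 1, RISpace.rearr g t * RISpace.psi I m t) ≤ C * X.norm g,
      ∀ k : ℕ, 1 ≤ k → k ≤ m - 1 → ∃ C : ℝ≥0, 0 < C ∧ ∀ g, RISpace.MPlus g →
        RISpace.powNorm X ((m : ℝ) / ((m : ℝ) - (k : ℝ))) g ≤ C * RISpace.optNorm X I k g,
      ∀ k : ℕ, 1 ≤ k → k ≤ m - 1 → ∃ C : ℝ≥0, 0 < C ∧
        ∀ f g, RISpace.MPlus f → RISpace.MPlus g →
          X.norm (fun x => f x * g x) ≤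
            C * RISpace.optNorm X I k f * RISpace.optNorm X I (m - k) g,
      ∃ k : ℕ, 1 ≤ k ∧ k ≤ m - 1 ∧ ∃ C : ℝ≥0, 0 < C ∧
        ∀ f g, RISpace.MPlus f → RISpace.MPlus g →
          X.norm (fun x => f x * g x) ≤
            C * RISpace.optNorm X I k f * RISpace.optNorm X I (m - k) g,
      ∃ k : ℕ, 1 ≤ k ∧ k ≤ m - 1 ∧ ∃ C : ℝ≥0, 0 < C ∧
        ∀ f g, RISpace.MPlus f → RISpace.MPlus g →
          X.norm (fun x => (RISpace.hardy I)^[k] f x * (RISpace.hardy I)^[m - k] g x) ≤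
            C * X.norm f * X.norm g,
      ∃ C : ℝ≥0, 0 < C ∧ ∀ t ∈ Ioo (0 : ℝ) 1,
        RISpace.invInt I 0 t ^ m ≤ C * RISpace.fundamental X t
    ] := by
  open RISpace in
  have hdens : ∀ {C : ℝ≥0}, (∀ t ∈ Ioo (0 : ℝ) 1, invInt I 0 t ^ m ≤ C * fundamental X t) →
      ∀ t ∈ Ioo (0 : ℝ) 1, densInt I 0 t ^ m ≤ C * fundamental X t := by
    intro C h t ht
    rw [← invInt_eq_densInt le_rfl ht.2.le]
    exact h t ht
  tfae_have 7 → 1 := by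
    rintro ⟨C, hC, h⟩
    refine ⟨⟨1 / 2, by norm_num, ?_⟩, C * 2, by positivity, fun g hg => ?_⟩
    · have h1 := h (1 / 2) (by norm_num)
      by_contra hcon
      rw [not_lt, top_le_iff] at hcon
      rw [hcon, ENNReal.top_pow (by omega), top_le_iff] at h1
      exact ENNReal.mul_ne_top ENNReal.coe_ne_top (RISpace.fundamental_ne_top X) h1
    · refine iSup₂_le fun t ht => ?_
      calc RISpace.maxRearr g t * RISpace.psi I m t
          ≤ RISpace.maxRearr g t * (C * RISpace.fundamental X t) := mul_le_mul_right (h t ht) _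
        _ = C * (RISpace.maxRearr g t * RISpace.fundamental X t) := by ring
        _ ≤ C * (2 * X.norm g) :=
            mul_le_mul_right (RISpace.maxRearr_mul_fundamental_le X hg ht) _
        _ = _ := by push_cast; ring
  tfae_have 1 → 2 := by
    rintro ⟨h0, C, hC, h⟩
    refine ⟨h0, C, hC, fun g hg => le_trans ?_ (h g hg)⟩
    exact iSup₂_mono fun t ht => mul_le_mul_left (RISpace.rearr_le_maxRearr g ht.1) _
  tfae_have 2 → 7 := by
    rintro ⟨-, C, hC, h⟩
    refine ⟨2 ^ m * C, by positivity, fun t ht => ?_⟩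
    -- The rearrangement of `χ_(0,t)` is tested at `t/2`, where it is at least 1; doubling of `Φ`
    -- then costs `2^m`.
    have ht2 : t / 2 ∈ Ioo (0 : ℝ) 1 := ⟨by linarith [ht.1], by linarith [ht.1, ht.2]⟩
    have h1 := (le_iSup₂ (f := fun (s : ℝ) (_ : s ∈ Ioo (0 : ℝ) 1) =>
      RISpace.rearr ((Ioo 0 t).indicator fun _ => 1) s * RISpace.psi I m s) (t / 2) ht2).trans
      (h _ (RISpace.measurable_indicator_one t).aemeasurable)
    have h2 := RISpace.rearr_indicator_one (by linarith [ht.1] : t / 2 < t) ht2.1.le ht.2.le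
    rw [RISpace.invInt_eq_densInt le_rfl ht.2.le]
    calc RISpace.densInt I 0 t ^ m ≤ (2 * RISpace.densInt I 0 (t / 2)) ^ m := by
          gcongr
          exact RISpace.densInt_zero_le_two_mul hImono ht.1 ht.2.le
      _ = 2 ^ m * (1 * RISpace.psi I m (t / 2)) := by
          rw [mul_pow, one_mul, RISpace.psi, RISpace.invInt_eq_densInt le_rfl ht2.2.le]
      _ ≤ 2 ^ m * (C * RISpace.fundamental X t) :=
          mul_le_mul_right ((mul_le_mul_left h2 _).trans h1) _
      _ = _ := by push_cast; ring
  tfae_have 7 → 3 := by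
    rintro ⟨C, hC, h⟩ k hk hkm
    exact RISpace.exists_powNorm_le_optNorm X hImono hk (by omega) (hdens h)
  tfae_have 3 → 4 := by
    intro h k hk hkm
    obtain ⟨C₁, hC₁, h₁⟩ := h k hk hkm
    obtain ⟨C₂, hC₂, h₂⟩ := h (m - k) (by omega) (by omega)
    refine ⟨2 * C₁ * C₂, by positivity, fun f g hf hg => ?_⟩
    -- Using (iii) with `m - k` in place of `k` gives the conjugate exponent `m/k`.
    have hq : (m : ℝ) / ((m : ℝ) - ((m - k : ℕ) : ℝ)) = (m : ℝ) / k := by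
      rw [Nat.cast_sub (by omega)]; congr 1; ring
    have h₂' := h₂ g hg
    rw [hq] at h₂'
    have hkm' : k < m := by omega
    refine (RISpace.norm_mul_le_powNorm X (RISpace.holderConjugate_div hk hkm') hf hg).trans ?_
    calc _ ≤ 2 * ((C₁ * RISpace.optNorm X I k f) * (C₂ * RISpace.optNorm X I (m - k) g)) :=
          mul_le_mul_right (mul_le_mul' (h₁ f hf) h₂') _
      _ = _ := by push_cast; ring
  tfae_have 4 → 5 := fun h => ⟨1, le_rfl, by omega, h 1 le_rfl (by omega)⟩
  tfae_have 5 → 6 := by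
    rintro ⟨k, hk, hkm, C, hC, h⟩
    refine ⟨k, hk, hkm, C, hC, fun f g hf hg => ?_⟩
    have hk' : 1 ≤ m - k := by omega
    refine (h _ _ (RISpace.hardy_iterate_antitone I f hk).measurable.aemeasurable
      (RISpace.hardy_iterate_antitone I g hk').measurable.aemeasurable).trans ?_
    exact mul_le_mul' (mul_le_mul_right (RISpace.optNorm_hardy_iterate_le X hImono hk hf) _)
      (RISpace.optNorm_hardy_iterate_le X hImono hk' hg)
  tfae_have 6 → 7 := by
    rintro ⟨k, hk, hkm, C, hC, h⟩
    obtain ⟨K, hK, h'⟩ :=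
      RISpace.exists_densInt_pow_le_fundamental X hIpos hImono hk (by omega) h
    refine ⟨K, hK, fun t ht => ?_⟩
    rw [RISpace.invInt_eq_densInt le_rfl ht.2.le]
    exact h' t ht
  tfae_finish
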